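/- Let $n\ge 1$ and let $u:\mathbb{C}^n\to\mathbb{R}$ be a $C^\infty$ function that is convex on $\mathbb{C}^n=\mathbb{R}^{2n}$ (not necessarily strictly convex). Write $z^j=x^j+\sqrt{-1}\,y^j$, $\frac{\partial}{\partial z^j}=\frac12\left(\frac{\partial}{\partial x^j}-\sqrt{-1}\frac{\partial}{\partial y^j}\right)$, $\frac{\partial}{\partial \bar z^j}=\frac12\left(\frac{\partial}{\partial x^j}+\sqrt{-1}\frac{\partial}{\partial y^j}\right)$ and $\partial\bar\partial u=\left(\frac{\partial^2u}{\partial z^j\,\partial\bar z^k}\right)_{1\le j,k\le n}$. Suppose that at every point $x\in\mathbb{C}^n=\mathbb{R}^{2n}$ one has $\det\partial\bar\partial u(x)>0$ and $$\ln\det\partial\bar\partial u(x)=\tfrac12\,x\cdot Du(x)-u(x),$$ where $x\cdot Du(x)$ is the Euclidean inner product of $x$ with the real gradient of $u$ in $\mathbb{R}^{2n}$. Suppose also that $u$ is toric, that is, $$u(z^1,\dots,z^n)=u\left(e^{\sqrt{-1}\,t^1}z^1,\dots,e^{\sqrt{-1}\,t^n}z^n\right)\quad\text{for all }(z^1,\dots,z^n)\in\mathbb{C}^n\text{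 and all }(t^1,\dots,t^n)\in\mathbb{R}^n.$$ Then $u$ is quadratic, that is, a real polynomial of degree two in the $2n$ real coordinates $x^1,\dots,x^n,y^1,\dots,y^n$. -/

import Mathlib

open scoped ContDiff

noncomputable section

/-- The Wirtinger operator `∂/∂zʲ = ½ (∂/∂xʲ - i ∂/∂yʲ)` applied to `f : ℂⁿ → ℂ`, where
`zʲ = xʲ + i yʲ` and the partial derivatives are real directional derivatives. -/
def dz {n : ℕ} (j : Fin n) (f : (Fin n → ℂ) → ℂ) (z : Fin n → ℂ) : ℂ :=
  (1 / 2) * (fderiv ℝ f z (Pi.single j 1) - Complex.I * fderiv ℝ f z (Pi.single j Complex.I))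

/-- The Wirtinger operator `∂/∂z̄ᵏ = ½ (∂/∂xᵏ + i ∂/∂yᵏ)`. -/
def dzbar {n : ℕ} (k : Fin n) (f : (Fin n → ℂ) → ℂ) (z : Fin n → ℂ) : ℂ :=
  (1 / 2) * (fderiv ℝ f z (Pi.single k 1) + Complex.I * fderiv ℝ f z (Pi.single k Complex.I))

/-- The complex Hessian `∂∂̄u = (∂²u / ∂zʲ ∂z̄ᵏ)`. -/
def complexHessian {n : ℕ} (u : (Fin n → ℂ) → ℝ) (z : Fin n → ℂ) : Matrix (Fin n) (Fin n) ℂ :=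
  Matrix.of fun j k => dz j (dzbar k fun w => (u w : ℂ)) z

/-- `u` solves `ln det ∂∂̄u = ½ x·Du - u` on all of `ℂⁿ`. The determinant (real, since the
complex Hessian of a smooth real function is Hermitian) has to be positive for the logarithm to
make sense. The radial derivative `x·Du(x)` in `ℝ²ⁿ = ℂⁿ` is the real derivative of `u` at `x`
in the direction `x`. -/
def SolvesShrinkerEq {n : ℕ} (u : (Fin n → ℂ) → ℝ) : Prop :=
  ∀ x : Fin n → ℂ, 0 < (complexHessian u x).det.re ∧
    Real.log (complexHessian u x).det.re = (1 / 2) * fderiv ℝ u x x - u x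

/-- Invariance under `zʲ ↦ exp(i tʲ) zʲ`. -/
def IsToric {n : ℕ} (u : (Fin n → ℂ) → ℝ) : Prop :=
  ∀ (t : Fin n → ℝ) (z : Fin n → ℂ),
    u z = u fun j => Complex.exp (Complex.I * (t j : ℂ)) * z j

/-- `u` is a real polynomial of degree exactly two in the `2n` real coordinates of `ℂⁿ`: a nonzero
real quadratic form plus a real-linear form plus a constant. -/
def IsQuadratic {n : ℕ} (u : (Fin n → ℂ) → ℝ) : Prop :=
  ∃ (Q : QuadraticForm ℝ (Fin n → ℂ)) (l : (Fin n → ℂ) →ₗ[ℝ] ℝ) (c : ℝ),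
    Q ≠ 0 ∧ ∀ z, u z = Q z + l z + c

end

/-!
In logarithmic coordinates `sⱼ = log |zⱼ|²` a toric `u` becomes a function `v` on `ℝⁿ`, and the
equation becomes the real Monge-Ampère equation
`det D²v = exp (∑ sᵢ + ∑ ∂ᵢv - v)` (`det_euclideanHess_eq_exp`). Convexity of `u` makes `D²v`
positive definite and every `∂ᵢv` positive, and the tangent plane of `u` at `(1, …, 1)` gives
`v ≥ a + c ∑ exp (sᵢ / 2)` with `c > 0`, so that `∇v` is a diffeomorphism of `ℝⁿ` onto the open
positive orthant and `T = log ∇v` is a diffeomorphism of `ℝⁿ`.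

With `p = exp (∑ sᵢ - v)` and `p₀(η) = exp (∑ (ηᵢ - exp ηᵢ))`, the equation says exactly that `T`
pushes `p` to `p₀`, that is `p = det DT · p₀ ∘ T`, while `∂ⱼp = -(exp Tⱼ - 1) p`. Four integrations
by parts in the `j`-th coordinate, together with this change of variables, give
`∫ ∂ⱼTⱼ p = ∫ Tⱼ (exp Tⱼ - 1) p = ∫ ηⱼ (exp ηⱼ - 1) p₀ = ∫ p₀ = ∫ p` and, for `S = T⁻¹`,
`∫ ∂ⱼSⱼ p₀ = ∫ Sⱼ (exp ηⱼ - 1) p₀ = ∫ sⱼ (exp Tⱼ - 1) p = ∫ p = ∫ p₀`.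
Hence the `p`-average of `(DT)ⱼⱼ + (DT⁻¹)ⱼⱼ` is `2`. But `DT = diag(∇v)⁻¹ D²v`, so the product of
these two entries is `(D²v)ⱼⱼ (D²v)⁻¹ⱼⱼ ≥ 1`, and their sum is at least `2` pointwise. Equality
holds everywhere (`transport_rigidity`), which forces `D²v = diag(∇v)`
(`hess_eq_diagonal_of_realMongeAmpere`). Integrating, `v = b + ∑ cᵢ exp sᵢ`, that is,
`u = b + ∑ cᵢ |zᵢ|²`. This is the uniqueness of moment measures, proved by transport in both
directions. No boundary terms have to be estimated: in one variable they vanish as soon as the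
density is unimodal, decays, and the other integrand is integrable
(`integral_deriv_mul_of_monotone`).
-/

section

open scoped ContDiff Matrix
open MeasureTheory Filter Topology Set

/-! ### Integration by parts against unimodal densities -/

/-- If `f` is somewhere nonnegative, the tail `∫ₜ^∞ f (-p')` dominates `f t * p t`; otherwise `f` is
bounded near `+∞`. -/
theorem tendsto_mul_atTop_zero_of_integrable {f p p' : ℝ → ℝ} {a : ℝ} (hf : Monotone f)
    (hp : ∀ t, HasDerivAt p (p' t) t) (hpos : ∀ t, 0 < p t) (hp' : ∀ t, a ≤ t → p' t ≤ 0)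
    (hlim : Tendsto p atTop (𝓝 0)) (hint : Integrable fun t => f t * p' t) :
    Tendsto (fun t => f t * p t) atTop (𝓝 0) := by
  by_cases h : ∃ b, 0 ≤ f b
  · obtain ⟨b, hb⟩ := h
    have htail : Tendsto (fun t => -∫ x in Ioi t, f x * p' x) atTop (𝓝 0) := by
      simpa using (tendsto_integral_Ioi_zero (f := fun t => f t * p' t) (μ := volume)
        tendsto_id ).neg
    refine tendsto_of_tendsto_of_tendsto_of_le_of_le' tendsto_const_nhds htail ?_ ?_
    · filter_upwards [eventually_ge_atTop b] with t ht
      exact mul_nonneg (hb.trans (hf ht)) (hpos t).le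
    · filter_upwards [eventually_ge_atTop b, eventually_ge_atTop a] with t htb hta
      have hi : IntegrableOn p' (Ioi t) :=
        integrableOn_Ioi_deriv_of_nonpos' (fun x _ => hp x)
          (fun x hx => hp' x (hta.trans (le_of_lt hx))) hlim
      have he : ∫ x in Ioi t, p' x = 0 - p t :=
        integral_Ioi_of_hasDerivAt_of_nonpos' (fun x _ => hp x)
          (fun x hx => hp' x (hta.trans (le_of_lt hx))) hlim
      have hle : ∫ x in Ioi t, f x * p' x ≤ ∫ x in Ioi t, f t * p' x := by
        refine setIntegral_mono_on hint.integrableOn (hi.const_mul _) measurableSet_Ioi ?_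
        intro x hx
        exact mul_le_mul_of_nonpos_right (hf (le_of_lt hx)) (hp' x (hta.trans (le_of_lt hx)))
      rw [integral_const_mul, he] at hle
      linarith
  · push Not at h
    have h0 : Tendsto (fun t => f 0 * p t) atTop (𝓝 0) := by simpa using hlim.const_mul (f 0)
    refine tendsto_of_tendsto_of_tendsto_of_le_of_le' h0 tendsto_const_nhds ?_ ?_
    · filter_upwards [eventually_ge_atTop 0] with t ht
      exact mul_le_mul_of_nonneg_right (hf ht) (hpos t).le
    · exact Eventually.of_forall fun t => mul_nonpos_of_nonpos_of_nonneg (h t).le (hpos t).le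

theorem tendsto_mul_atBot_zero_of_integrable {f p p' : ℝ → ℝ} {a : ℝ} (hf : Monotone f)
    (hp : ∀ t, HasDerivAt p (p' t) t) (hpos : ∀ t, 0 < p t) (hp' : ∀ t, t ≤ a → 0 ≤ p' t)
    (hlim : Tendsto p atBot (𝓝 0)) (hint : Integrable fun t => f t * p' t) :
    Tendsto (fun t => f t * p t) atBot (𝓝 0) := by
  have h := tendsto_mul_atTop_zero_of_integrable (f := fun t => -f (-t)) (p := fun t => p (-t))
    (p' := fun t => -p' (-t)) (a := -a) (fun x y hxy => neg_le_neg (hf (neg_le_neg hxy)))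
    (fun t => by simpa [Function.comp_def] using (hp (-t)).scomp t (hasDerivAt_neg t))
    (fun t => hpos _)
    (fun t ht => by simpa using hp' (-t) (by linarith))
    (hlim.comp tendsto_neg_atTop_atBot) (by simpa using hint.comp_neg)
  simpa [Function.comp_def] using (h.comp tendsto_neg_atBot_atTop).neg

/-- Integration by parts on the line for a nondecreasing `f` and a unimodal `p` vanishing at `±∞`.
Integrability of `f * p'` alone gives that of `f' * p` and kills the boundary terms. -/
theorem integral_deriv_mul_of_monotone {f f' p p' : ℝ → ℝ} {a b : ℝ}
    (hf : ∀ t, HasDerivAt f (f' t) t) (hf' : ∀ t, 0 ≤ f' t) (hfc : Continuous f')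
    (hp : ∀ t, HasDerivAt p (p' t) t) (hpos : ∀ t, 0 < p t)
    (ha : ∀ t, a ≤ t → p' t ≤ 0) (hb : ∀ t, t ≤ b → 0 ≤ p' t)
    (hlimt : Tendsto p atTop (𝓝 0)) (hlimb : Tendsto p atBot (𝓝 0))
    (hint : Integrable fun t => f t * p' t) :
    Integrable (fun t => f' t * p t) ∧ ∫ t, f' t * p t = -∫ t, f t * p' t := by
  have hmono : Monotone f := monotone_of_deriv_nonneg (fun t => (hf t).differentiableAt)
    fun t => by rw [(hf t).deriv]; exact hf' t
  have ht := tendsto_mul_atTop_zero_of_integrable hmono hp hpos ha hlimt hint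
  have hbo := tendsto_mul_atBot_zero_of_integrable hmono hp hpos hb hlimb hint
  have hpc : Continuous p := continuous_iff_continuousAt.2 fun t => (hp t).continuousAt
  have hc : Continuous fun t => f' t * p t := hfc.mul hpc
  have hI : Integrable fun t => f' t * p t := by
    refine integrable_of_intervalIntegral_norm_tendsto (0 - 0 - ∫ t, f t * p' t)
      (fun i : ℝ => hc.integrableOn_Ioc) tendsto_neg_atTop_atBot tendsto_id ?_
    refine Tendsto.congr ?_ ((ht.sub (hbo.comp tendsto_neg_atTop_atBot)).sub
      (intervalIntegral_tendsto_integral hint tendsto_neg_atTop_atBot tendsto_id))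
    intro i
    have h1 : ∫ t in (-i)..i, ((f' t * p t) + (f t * p' t)) = f i * p i - f (-i) * p (-i) :=
      intervalIntegral.integral_eq_sub_of_hasDerivAt (f := fun t => f t * p t)
        (fun x _ => (hf x).mul (hp x))
        ((hc.intervalIntegrable _ _).add hint.intervalIntegrable)
    rw [intervalIntegral.integral_add (hc.intervalIntegrable _ _) hint.intervalIntegrable] at h1
    have h2 : ∀ t, ‖f' t * p t‖ = f' t * p t := fun t =>
      Real.norm_of_nonneg (mul_nonneg (hf' t) (hpos t).le)
    simp only [h2, Function.comp, id]
    linarith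
  refine ⟨hI, ?_⟩
  have := integral_mul_deriv_eq_deriv_mul (fun x _ => hf x) (fun x _ => hp x) hint hI hbo ht
  linarith

theorem exists_deriv_neg_of_tendsto_atTop_zero {p p' : ℝ → ℝ}
    (hp : ∀ t, HasDerivAt p (p' t) t) (hpos : ∀ t, 0 < p t) (hlimt : Tendsto p atTop (𝓝 0)) :
    ∃ a, p' a < 0 := by
  by_contra! h
  have hm : Monotone p := monotone_of_deriv_nonneg (fun t => (hp t).differentiableAt)
    fun t => by rw [(hp t).deriv]; exact h t
  have := hm.ge_of_tendsto hlimt 0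
  exact absurd (hpos 0) (by linarith)

theorem exists_deriv_pos_of_tendsto_atBot_zero {p p' : ℝ → ℝ}
    (hp : ∀ t, HasDerivAt p (p' t) t) (hpos : ∀ t, 0 < p t) (hlimb : Tendsto p atBot (𝓝 0)) :
    ∃ a, 0 < p' a := by
  by_contra! h
  have hm : Antitone p := antitone_of_deriv_nonpos (fun t => (hp t).differentiableAt)
    fun t => by rw [(hp t).deriv]; exact h t
  have := hm.ge_of_tendsto hlimb 0
  exact absurd (hpos 0) (by linarith)

/-- The case of a log-concave density, `q = -(log p)'` being nondecreasing. -/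
theorem integral_deriv_mul_of_logConcave {f f' p q : ℝ → ℝ}
    (hf : ∀ t, HasDerivAt f (f' t) t) (hf' : ∀ t, 0 ≤ f' t) (hfc : Continuous f')
    (hp : ∀ t, HasDerivAt p (-(q t * p t)) t) (hpos : ∀ t, 0 < p t) (hq : Monotone q)
    (hlimt : Tendsto p atTop (𝓝 0)) (hlimb : Tendsto p atBot (𝓝 0))
    (hint : Integrable fun t => f t * q t * p t) :
    Integrable (fun t => f' t * p t) ∧ ∫ t, f' t * p t = ∫ t, f t * q t * p t := by
  obtain ⟨a, ha⟩ := exists_deriv_neg_of_tendsto_atTop_zero hp hpos hlimt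
  obtain ⟨b, hb⟩ := exists_deriv_pos_of_tendsto_atBot_zero hp hpos hlimb
  have ha' : 0 < q a := by
    by_contra! h
    nlinarith [hpos a]
  have hb' : q b < 0 := by
    by_contra! h
    nlinarith [hpos b]
  have e : ∀ t, f t * -(q t * p t) = -(f t * q t * p t) := fun t => by ring
  have := integral_deriv_mul_of_monotone (a := a) (b := b) hf hf' hfc hp hpos
    (fun t ht => neg_nonpos.2 (mul_nonneg (ha'.le.trans (hq ht)) (hpos t).le))
    (fun t ht => neg_nonneg.2 (mul_nonpos_of_nonpos_of_nonneg ((hq ht).trans hb'.le) (hpos t).le))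
    hlimt hlimb (by simp only [e]; exact hint.neg)
  simpa only [e, integral_neg, neg_neg] using this

/-- An identity of integrals along every line parallel to the `j`-th axis integrates to an identity
on `ℝⁿ`; integrability of the nonnegative function `G` is part of the conclusion. -/
theorem integrable_and_integral_eq_of_lines {n : ℕ} (j : Fin n) {F G : (Fin n → ℝ) → ℝ}
    (hF : Integrable F) (hG : Measurable G) (hG0 : ∀ x, 0 ≤ G x)
    (hline : ∀ x, Integrable (fun t => F (Function.update x j t)) →
      Integrable (fun t => G (Function.update x j t)) ∧
        ∫ t, G (Function.update x j t) = ∫ t, F (Function.update x j t)) :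
    Integrable G ∧ ∫ x, G x = ∫ x, F x := by
  obtain _ | m := n
  · exact j.elim0
  have hmp := (volume_preserving_piFinSuccAbove (fun _ : Fin (m + 1) => ℝ) j).symm
  set e := (MeasurableEquiv.piFinSuccAbove (fun _ : Fin (m + 1) => ℝ) j).symm with he
  have hupd : ∀ (t : ℝ) (y : Fin m → ℝ), e (t, y) = Function.update (e (0, y)) j t := by
    intro t y
    simp [he, MeasurableEquiv.piFinSuccAbove, Fin.insertNthEquiv]
  have hF' : Integrable (fun z => F (e z)) (volume.prod volume) :=
    (hmp.integrable_comp_emb e.measurableEmbedding).2 hF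
  have hl : ∀ᵐ y : Fin m → ℝ, Integrable (fun t => G (e (t, y))) ∧
        ∫ t, G (e (t, y)) = ∫ t, F (e (t, y)) := by
    filter_upwards [hF'.prod_left_ae] with y hy
    have := hline (e (0, y))
    simp only [← hupd] at this
    exact this hy
  have hGm : Measurable fun z => G (e z) := hG.comp e.measurable
  have hG' : Integrable (fun z => G (e z)) (volume.prod volume) := by
    rw [integrable_prod_iff' hGm.aestronglyMeasurable]
    refine ⟨hl.mono fun y hy => hy.1, ?_⟩
    refine (hF'.integral_prod_right).congr ?_
    filter_upwards [hl] with y hy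
    rw [← hy.2]
    simp only [Real.norm_of_nonneg (hG0 _)]
  refine ⟨(hmp.integrable_comp_emb e.measurableEmbedding).1 hG', ?_⟩
  rw [← hmp.integral_comp e.measurableEmbedding G, ← hmp.integral_comp e.measurableEmbedding F]
  change ∫ z, G (e z) ∂(volume.prod volume) = ∫ z, F (e z) ∂(volume.prod volume)
  rw [integral_prod_symm _ hG', integral_prod_symm _ hF']
  exact integral_congr_ae (hl.mono fun y hy => hy.2)

/-- Integration by parts in the `j`-th coordinate: `f'` and `-q * p` are the `j`-th partial
derivatives of `f` and `p`. -/
theorem integral_partial_mul_of_logConcave {n : ℕ} (j : Fin n) {f f' p q : (Fin n → ℝ) → ℝ}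
    (hf : ∀ x t, HasDerivAt (fun t => f (Function.update x j t)) (f' (Function.update x j t)) t)
    (hf' : ∀ x, 0 ≤ f' x) (hfc : Continuous f')
    (hp : ∀ x t, HasDerivAt (fun t => p (Function.update x j t))
      (-(q (Function.update x j t) * p (Function.update x j t))) t)
    (hpos : ∀ x, 0 < p x) (hpc : Continuous p)
    (hq : ∀ x, Monotone fun t => q (Function.update x j t))
    (hlimt : ∀ x, Tendsto (fun t => p (Function.update x j t)) atTop (𝓝 0))
    (hlimb : ∀ x, Tendsto (fun t => p (Function.update x j t)) atBot (𝓝 0))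
    (hint : Integrable fun x => f x * q x * p x) :
    Integrable (fun x => f' x * p x) ∧ ∫ x, f' x * p x = ∫ x, f x * q x * p x :=
  integrable_and_integral_eq_of_lines j hint (hfc.mul hpc).measurable
    (fun x => mul_nonneg (hf' x) (hpos x).le) fun x hx =>
    integral_deriv_mul_of_logConcave (hf x) (fun _ => hf' _)
      (hfc.comp (continuous_const.update j continuous_id)) (hp x) (fun _ => hpos _) (hq x)
      (hlimt x) (hlimb x) hx

/-! ### Exponentially decaying densities -/

/-- The tangent line of the exponential at the point where its slope is `2k`. -/
theorem exists_mul_abs_le_mul_exp_sub {c b k : ℝ} (hc : 0 < c) (hb : 0 < b) (hk : 0 < k) :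
    ∃ D, ∀ t : ℝ, k * |t| ≤ c * Real.exp (b * t) - k * t + D := by
  set L := Real.log (2 * k / (c * b)) with hL
  have hcL : c * Real.exp L * b = 2 * k := by
    rw [hL, Real.exp_log (by positivity)]
    field_simp
  have hpos : 0 < c * Real.exp L := by positivity
  refine ⟨c * Real.exp L * |L - 1|, fun t => ?_⟩
  have h := Real.add_one_le_exp (b * t - L)
  have e : c * Real.exp (b * t) = c * Real.exp L * Real.exp (b * t - L) := by
    rw [mul_assoc, ← Real.exp_add]; ring_nf
  have habs := le_abs_self (L - 1)
  rcases le_total 0 t with ht | ht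
  · rw [abs_of_nonneg ht, e]
    nlinarith
  · rw [abs_of_nonpos ht]
    have : 0 ≤ c * Real.exp (b * t) := by positivity
    have : 0 ≤ c * Real.exp L * |L - 1| := by positivity
    linarith

theorem integrable_exp_neg_mul_abs {a : ℝ} (ha : 0 < a) :
    Integrable fun t : ℝ => Real.exp (-(a * |t|)) := by
  rw [← integrableOn_univ, ← Iic_union_Ioi (a := (0 : ℝ))]
  refine IntegrableOn.union ?_ ?_
  · refine (integrableOn_exp_mul_Iic ha 0).congr_fun (fun t ht => ?_) measurableSet_Iic
    simp only [abs_of_nonpos (mem_Iic.1 ht)]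
    congr 1; ring
  · refine (exp_neg_integrableOn_Ioi 0 ha).congr_fun (fun t ht => ?_) measurableSet_Ioi
    simp only [abs_of_pos (mem_Ioi.1 ht)]
    congr 1; ring

theorem integrable_sq_mul_exp_neg_abs : Integrable fun t : ℝ => t ^ 2 * Real.exp (-|t|) := by
  refine ((integrable_exp_neg_mul_abs (a := 1 / 2) (by norm_num)).const_mul 8).mono'
    (by fun_prop) (Eventually.of_forall fun t => ?_)
  rw [Real.norm_of_nonneg (by positivity)]
  have h1 : t ^ 2 ≤ 8 * Real.exp (|t| / 2) := by
    have := Real.quadratic_le_exp_of_nonneg (x := |t| / 2) (by positivity)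
    nlinarith [sq_abs t, abs_nonneg t]
  calc t ^ 2 * Real.exp (-|t|) ≤ 8 * Real.exp (|t| / 2) * Real.exp (-|t|) := by gcongr
    _ = 8 * Real.exp (-(1 / 2 * |t|)) := by rw [mul_assoc, ← Real.exp_add]; ring_nf

theorem exists_sub_exp_le_sub_abs : ∃ D, ∀ t : ℝ, t - Real.exp t ≤ D - |t| := by
  obtain ⟨D, hD⟩ := exists_mul_abs_le_mul_exp_sub one_pos one_pos one_pos
  exact ⟨D, fun t => by have := hD t; simp only [one_mul] at this; linarith⟩

theorem integrable_exp_sub_exp : Integrable fun t : ℝ => Real.exp (t - Real.exp t) := by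
  obtain ⟨D, hD⟩ := exists_sub_exp_le_sub_abs
  refine ((integrable_exp_neg_mul_abs (a := 1) (by norm_num)).const_mul (Real.exp D)).mono'
    (by fun_prop) (Eventually.of_forall fun t => ?_)
  rw [Real.norm_of_nonneg (by positivity), ← Real.exp_add]
  exact Real.exp_le_exp.2 (by linarith [hD t])

theorem integrable_sq_exp_sub_one_mul :
    Integrable fun t : ℝ => (Real.exp t - 1) ^ 2 * Real.exp (t - Real.exp t) := by
  obtain ⟨D, hD⟩ := exists_mul_abs_le_mul_exp_sub one_pos one_pos two_pos
  refine ((integrable_exp_neg_mul_abs (a := 1) (by norm_num)).const_mul (Real.exp |D|)).mono'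
    (by fun_prop) (Eventually.of_forall fun t => ?_)
  have hDt := hD t
  simp only [one_mul] at hDt
  have hDD := le_abs_self D
  rw [Real.norm_of_nonneg (by positivity), ← Real.exp_add]
  have hp := Real.exp_pos t
  by_cases ht : 0 ≤ t
  · rw [abs_of_nonneg ht] at *
    calc (Real.exp t - 1) ^ 2 * Real.exp (t - Real.exp t)
        ≤ (Real.exp t) ^ 2 * Real.exp (t - Real.exp t) := by
          have := Real.one_le_exp ht
          gcongr
          linarith
      _ = Real.exp (t + t + (t - Real.exp t)) := by rw [Real.exp_add, Real.exp_add]; ring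
      _ ≤ Real.exp (|D| + -(1 * t)) := Real.exp_le_exp.2 (by linarith)
  · push Not at ht
    have h1 : (Real.exp t - 1) ^ 2 ≤ 1 := by
      have : Real.exp t < 1 := Real.exp_lt_one_iff.2 ht
      nlinarith
    calc (Real.exp t - 1) ^ 2 * Real.exp (t - Real.exp t) ≤ 1 * Real.exp (|D| + -(1 * |t|)) := by
          rw [abs_of_neg ht]
          gcongr
          linarith [abs_nonneg D]
      _ = _ := one_mul _

theorem integrable_coord_mul_prod {n : ℕ} (j : Fin n) {h k : ℝ → ℝ} (hk : Integrable k)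
    (hhk : Integrable fun t => h t * k t) :
    Integrable fun x : Fin n → ℝ => h (x j) * ∏ i, k (x i) := by
  have := Integrable.fintype_prod (ι := Fin n) (μ := fun _ => (volume : Measure ℝ))
    (f := fun i t => (if i = j then h t else 1) * k t) (fun i => by
      by_cases hi : i = j
      · simpa [hi] using hhk
      · simpa [hi] using hk)
  refine this.congr (Eventually.of_forall fun x => ?_)
  simp only [Finset.prod_mul_distrib, Finset.prod_ite_eq', Finset.mem_univ, if_true]

/-- `p` is bounded above by a multiple of `exp (-∑ |sᵢ|)`. -/
def HasExpDecay {n : ℕ} (p : (Fin n → ℝ) → ℝ) : Prop :=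
  ∃ C, ∀ s, p s ≤ C * Real.exp (-∑ i, |s i|)

theorem HasExpDecay.integrable_sq_mul {n : ℕ} {p : (Fin n → ℝ) → ℝ} (h : HasExpDecay p)
    (hc : Continuous p) (hpos : ∀ s, 0 < p s) (j : Fin n) :
    Integrable fun s => s j ^ 2 * p s := by
  obtain ⟨C, hC⟩ := h
  refine ((integrable_coord_mul_prod j (by simpa using integrable_exp_neg_mul_abs one_pos)
    integrable_sq_mul_exp_neg_abs).const_mul C).mono' (by fun_prop)
    (Eventually.of_forall fun s => ?_)
  rw [Real.norm_of_nonneg (mul_nonneg (sq_nonneg _) (hpos s).le), ← Real.exp_sum,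
    Finset.sum_neg_distrib, mul_left_comm]
  exact mul_le_mul_of_nonneg_left (hC s) (sq_nonneg _)

theorem HasExpDecay.integrable {n : ℕ} {p : (Fin n → ℝ) → ℝ} (h : HasExpDecay p)
    (hc : Continuous p) (hpos : ∀ s, 0 < p s) : Integrable p := by
  obtain ⟨C, hC⟩ := h
  have hI : Integrable fun s : Fin n → ℝ => ∏ i, Real.exp (-|s i|) :=
    Integrable.fintype_prod (f := fun (_ : Fin n) t => Real.exp (-|t|))
      (fun _ => by simpa using integrable_exp_neg_mul_abs one_pos)
  refine (hI.const_mul C).mono' (by fun_prop) (Eventually.of_forall fun s => ?_)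
  rw [Real.norm_of_nonneg (hpos s).le, ← Real.exp_sum, Finset.sum_neg_distrib]
  exact hC s

theorem HasExpDecay.tendsto_update {n : ℕ} {p : (Fin n → ℝ) → ℝ} (h : HasExpDecay p)
    (hpos : ∀ s, 0 < p s) (s : Fin n → ℝ) (j : Fin n) :
    Tendsto (fun t => p (Function.update s j t)) (cocompact ℝ) (𝓝 0) := by
  obtain ⟨C, hC⟩ := h
  have hC0 : 0 ≤ C := by
    by_contra! hlt
    exact absurd ((hpos s).trans_le (hC s)) (not_lt.2 (by
      exact mul_nonpos_of_nonpos_of_nonneg hlt.le (Real.exp_pos _).le))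
  have hlim : Tendsto (fun t : ℝ => C * Real.exp (-|t|)) (cocompact ℝ) (𝓝 0) := by
    simpa using ((Real.tendsto_exp_neg_atTop_nhds_zero.comp
      (tendsto_norm_cocompact_atTop (E := ℝ))).const_mul C)
  refine tendsto_of_tendsto_of_tendsto_of_le_of_le tendsto_const_nhds hlim
    (fun t => (hpos _).le) fun t => (hC _).trans ?_
  have : |t| ≤ ∑ i, |Function.update s j t i| := by
    simpa using Finset.single_le_sum (f := fun i => |Function.update s j t i|)
      (fun i _ => abs_nonneg _) (Finset.mem_univ j)
  gcongr

theorem integrable_mul_mul_of_sq {α : Type*} [MeasurableSpace α] {μ : Measure α} {a b p : α → ℝ}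
    (ha : AEStronglyMeasurable a μ) (hb : AEStronglyMeasurable b μ)
    (hp : AEStronglyMeasurable p μ) (hp0 : ∀ x, 0 ≤ p x)
    (hap : Integrable (fun x => a x ^ 2 * p x) μ) (hbp : Integrable (fun x => b x ^ 2 * p x) μ) :
    Integrable (fun x => a x * b x * p x) μ := by
  refine (hap.add hbp).mono' ((ha.mul hb).mul hp) (Eventually.of_forall fun x => ?_)
  rw [Real.norm_eq_abs, abs_mul, abs_of_nonneg (hp0 x)]
  simp only [Pi.add_apply, ← add_mul]
  refine mul_le_mul_of_nonneg_right ?_ (hp0 x)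
  rw [abs_mul]
  nlinarith [sq_nonneg (|a x| - |b x|), sq_abs (a x), sq_abs (b x), sq_nonneg (a x), sq_nonneg (b x)]

/-- The density `p₀(η) = ∏ exp (ηᵢ - exp ηᵢ)`: it is the density `exp (∑ sᵢ - v)` of the quadratic
solution `v = ∑ exp sᵢ`, for which `log ∇v` is the identity. -/
noncomputable def modelDensity {n : ℕ} (η : Fin n → ℝ) : ℝ := ∏ i, Real.exp (η i - Real.exp (η i))

theorem modelDensity_eq_exp {n : ℕ} (η : Fin n → ℝ) :
    modelDensity η = Real.exp (∑ i, (η i - Real.exp (η i))) := (Real.exp_sum _ _).symm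

theorem modelDensity_pos {n : ℕ} (η : Fin n → ℝ) : 0 < modelDensity η :=
  Finset.prod_pos fun _ _ => Real.exp_pos _

theorem continuous_modelDensity {n : ℕ} : Continuous (modelDensity (n := n)) := by
  unfold modelDensity
  fun_prop

theorem hasExpDecay_modelDensity {n : ℕ} : HasExpDecay (modelDensity (n := n)) := by
  obtain ⟨D, hD⟩ := exists_sub_exp_le_sub_abs
  refine ⟨Real.exp (∑ _i : Fin n, D), fun s => ?_⟩
  rw [modelDensity_eq_exp, ← Real.exp_add, ← Finset.sum_neg_distrib, ← Finset.sum_add_distrib]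
  exact Real.exp_le_exp.2 (Finset.sum_le_sum fun i _ => by linarith [hD (s i)])

theorem hasDerivAt_modelDensity_update {n : ℕ} (j : Fin n) (η : Fin n → ℝ) (t : ℝ) :
    HasDerivAt (fun t => modelDensity (Function.update η j t))
      (-((Real.exp (Function.update η j t j) - 1) * modelDensity (Function.update η j t))) t := by
  have hu : ∀ i, HasDerivAt (fun t => Function.update η j t i)
      ((Pi.single j (1 : ℝ) : Fin n → ℝ) i) t :=
    hasDerivAt_pi.1 (hasDerivAt_update η j t)
  simp only [modelDensity_eq_exp]
  have h := (HasDerivAt.fun_sum fun i (_ : i ∈ Finset.univ) => (hu i).fun_sub (hu i).exp).exp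
  rw [Finset.sum_eq_single (a := j) (s := Finset.univ)
    (f := fun i => _ - Real.exp (Function.update η j t i) * _) (fun i _ hi => by simp [hi])
    (by simp)] at h
  convert h using 1
  simp only [Pi.single_eq_same]
  ring

/-! ### Rigidity of transport to the model density -/

theorem transport_change_of_variables {n : ℕ} {T : (Fin n → ℝ) ≃ₜ (Fin n → ℝ)}
    {A : (Fin n → ℝ) → ((Fin n → ℝ) ≃L[ℝ] (Fin n → ℝ))}
    (hA : ∀ s, HasFDerivAt T (A s : (Fin n → ℝ) →L[ℝ] (Fin n → ℝ)) s) {p p₀ : (Fin n → ℝ) → ℝ}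
    (hdet : ∀ s, p s = |(A s : (Fin n → ℝ) →L[ℝ] (Fin n → ℝ)).det| * p₀ (T s))
    (g : (Fin n → ℝ) → ℝ) :
    (Integrable (fun η => g η * p₀ η) ↔ Integrable fun s => g (T s) * p s) ∧
      ∫ η, g η * p₀ η = ∫ s, g (T s) * p s := by
  have e : ∀ s, |(A s : (Fin n → ℝ) →L[ℝ] (Fin n → ℝ)).det| • (g (T s) * p₀ (T s)) =
      g (T s) * p s := fun s => by rw [hdet, smul_eq_mul]; ring
  have h1 := integrableOn_image_iff_integrableOn_abs_det_fderiv_smul (volume : Measure (Fin n → ℝ))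
    MeasurableSet.univ (fun s _ => (hA s).hasFDerivWithinAt) T.injective.injOn
    (fun η => g η * p₀ η)
  have h2 := integral_image_eq_integral_abs_det_fderiv_smul (volume : Measure (Fin n → ℝ))
    MeasurableSet.univ (fun s _ => (hA s).hasFDerivWithinAt) T.injective.injOn
    (fun η => g η * p₀ η)
  simp only [e, image_univ, T.range_coe, integrableOn_univ, setIntegral_univ] at h1 h2
  exact ⟨h1, h2⟩

/-- Let `T`, with derivative `A`, push the density `p` to `modelDensity`, where
`∂ⱼp = -(exp Tⱼ - 1) p`. If the `j`-th diagonal entries of `A` and `A⁻¹` have product at least `1`,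
then both are `1`: their sum is at least `2` pointwise and has `p`-average `2`. -/
theorem transport_rigidity {n : ℕ} {T : (Fin n → ℝ) ≃ₜ (Fin n → ℝ)}
    {A : (Fin n → ℝ) → ((Fin n → ℝ) ≃L[ℝ] (Fin n → ℝ))}
    (hA : ∀ s, HasFDerivAt T (A s : (Fin n → ℝ) →L[ℝ] (Fin n → ℝ)) s) (hT : ContDiff ℝ 1 T)
    {p : (Fin n → ℝ) → ℝ} (hpos : ∀ s, 0 < p s) (hpc : Continuous p) (hdecay : HasExpDecay p)
    (hdet : ∀ s, p s = |(A s : (Fin n → ℝ) →L[ℝ] (Fin n → ℝ)).det| * modelDensity (T s))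
    (j : Fin n)
    (hp : ∀ s t, HasDerivAt (fun t => p (Function.update s j t))
      (-((Real.exp (T (Function.update s j t) j) - 1) * p (Function.update s j t))) t)
    (hα : ∀ s, 0 < A s (Pi.single j 1) j) (hβ : ∀ s, 0 < (A s).symm (Pi.single j 1) j)
    (hαβ : ∀ s, 1 ≤ A s (Pi.single j 1) j * (A s).symm (Pi.single j 1) j) (s : Fin n → ℝ) :
    A s (Pi.single j 1) j = 1 ∧ (A s).symm (Pi.single j 1) j = 1 := by
  have hTs : ContDiff ℝ 1 T.symm := T.contDiff_symm hA hT
  have hAs : ∀ η, HasFDerivAt T.symm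
      ((A (T.symm η)).symm : (Fin n → ℝ) →L[ℝ] (Fin n → ℝ)) η := fun η =>
    T.toOpenPartialHomeomorph.hasFDerivAt_symm (mem_univ η) (hA _)
  have hαc : Continuous fun s => A s (Pi.single j 1) j := by
    have : Continuous fun s => fderiv ℝ T s (Pi.single j 1) j :=
      (continuous_apply j).comp ((hT.continuous_fderiv one_ne_zero).clm_apply continuous_const)
    simpa only [(hA _).fderiv, ContinuousLinearEquiv.coe_coe] using this
  have hβc : Continuous fun η => (A (T.symm η)).symm (Pi.single j 1) j := by
    have : Continuous fun s => fderiv ℝ T.symm s (Pi.single j 1) j :=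
      (continuous_apply j).comp ((hTs.continuous_fderiv one_ne_zero).clm_apply continuous_const)
    simpa only [(hAs _).fderiv, ContinuousLinearEquiv.coe_coe] using this
  have hcv := transport_change_of_variables hA hdet
  have hline : ∀ {F : (Fin n → ℝ) → (Fin n → ℝ)} {F' : (Fin n → ℝ) → (Fin n → ℝ) →L[ℝ] (Fin n → ℝ)}
      (_ : ∀ s, HasFDerivAt F (F' s) s) (s : Fin n → ℝ) (t : ℝ),
      HasDerivAt (fun t => F (Function.update s j t) j)
        (F' (Function.update s j t) (Pi.single j 1) j) t := fun hF s t =>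
    hasDerivAt_pi.1 ((hF _).comp_hasDerivAt t (hasDerivAt_update s j t)) j
  have htend : ∀ {ρ : (Fin n → ℝ) → ℝ}, HasExpDecay ρ → (∀ s, 0 < ρ s) → ∀ s,
      Tendsto (fun t => ρ (Function.update s j t)) atTop (𝓝 0) ∧
      Tendsto (fun t => ρ (Function.update s j t)) atBot (𝓝 0) := fun hd h0 s =>
    ⟨(hd.tendsto_update h0 s j).mono_left atTop_le_cocompact,
      (hd.tendsto_update h0 s j).mono_left atBot_le_cocompact⟩
  have hTmono : ∀ s, Monotone fun t => T (Function.update s j t) j := fun s =>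
    monotone_of_deriv_nonneg (fun t => (hline hA s t).differentiableAt)
      fun t => by rw [(hline hA s t).deriv]; exact (hα _).le
  have hqT : ∀ s, Monotone fun t => Real.exp (T (Function.update s j t) j) - 1 := fun s x y hxy =>
    sub_le_sub_right (Real.exp_le_exp.2 (hTmono s hxy)) 1
  have hq₀ : ∀ s : Fin n → ℝ, Monotone fun t => Real.exp (Function.update s j t j) - 1 :=
    fun s x y hxy => by simpa using hxy
  -- `Tⱼ (exp Tⱼ - 1) p` is controlled on the model side; `sⱼ (exp Tⱼ - 1) p` needs the decay of `p`
  -- for the factor `sⱼ` and the model side for the factor `exp Tⱼ - 1`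
  have hI₀ : Integrable fun η : Fin n → ℝ => (Real.exp (η j) - 1) ^ 2 * modelDensity η :=
    integrable_coord_mul_prod j integrable_exp_sub_exp integrable_sq_exp_sub_one_mul
  have hI₁ := (hcv _).1.1 hI₀
  have hJ₀ : Integrable fun η : Fin n → ℝ => η j * (Real.exp (η j) - 1) * modelDensity η :=
    integrable_mul_mul_of_sq (Continuous.aestronglyMeasurable (by fun_prop))
      (Continuous.aestronglyMeasurable (by fun_prop)) continuous_modelDensity.aestronglyMeasurable
      (fun η => (modelDensity_pos η).le)
      (hasExpDecay_modelDensity.integrable_sq_mul continuous_modelDensity modelDensity_pos j) hI₀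
  have hTc := T.continuous
  have hJ₁ : Integrable fun s : Fin n → ℝ => s j * (Real.exp (T s j) - 1) * p s :=
    integrable_mul_mul_of_sq (Continuous.aestronglyMeasurable (by fun_prop))
      (Continuous.aestronglyMeasurable (by fun_prop))
      hpc.aestronglyMeasurable (fun η => (hpos η).le)
      (hdecay.integrable_sq_mul hpc hpos j) hI₁
  -- integration by parts for `(p, Tⱼ)`, `(p₀, ηⱼ)`, `(p₀, Sⱼ)` and `(p, sⱼ)`
  have k₁ := integral_partial_mul_of_logConcave j (hline hA) (fun s => (hα s).le) hαc hp hpos hpc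
    hqT (fun s => (htend hdecay hpos s).1) (fun s => (htend hdecay hpos s).2)
    ((hcv fun η => η j * (Real.exp (η j) - 1)).1.1 hJ₀)
  have k₂ := integral_partial_mul_of_logConcave j (f := fun η => η j) (f' := fun _ => 1)
    (fun s t => by simpa using hasDerivAt_id' t) (fun s => zero_le_one) continuous_const
    (hasDerivAt_modelDensity_update j) modelDensity_pos continuous_modelDensity hq₀
    (fun s => (htend hasExpDecay_modelDensity modelDensity_pos s).1)
    (fun s => (htend hasExpDecay_modelDensity modelDensity_pos s).2) hJ₀
  have k₃ := integral_partial_mul_of_logConcave j (hline hAs) (fun s => (hβ _).le) hβc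
    (hasDerivAt_modelDensity_update j) modelDensity_pos continuous_modelDensity hq₀
    (fun s => (htend hasExpDecay_modelDensity modelDensity_pos s).1)
    (fun s => (htend hasExpDecay_modelDensity modelDensity_pos s).2)
    ((hcv fun η => T.symm η j * (Real.exp (η j) - 1)).1.2 (by simpa using hJ₁))
  have k₄ := integral_partial_mul_of_logConcave j (f := fun η => η j) (f' := fun _ => 1)
    (fun s t => by simpa using hasDerivAt_id' t) (fun s => zero_le_one) continuous_const
    hp hpos hpc hqT (fun s => (htend hdecay hpos s).1) (fun s => (htend hdecay hpos s).2) hJ₁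
  have hβi := (hcv fun η => (A (T.symm η)).symm (Pi.single j 1) j).1.1 k₃.1
  have e₁ : ∫ s, A s (Pi.single j 1) j * p s = ∫ s, 1 * p s := by
    rw [k₁.2, ← (hcv fun η => η j * (Real.exp (η j) - 1)).2, ← k₂.2, (hcv fun _ => 1).2]
  have e₂ : ∫ s, (A s).symm (Pi.single j 1) j * p s = ∫ s, 1 * p s := by
    have h := (hcv fun η => (A (T.symm η)).symm (Pi.single j 1) j).2
    have h' := (hcv fun η => T.symm η j * (Real.exp (η j) - 1)).2
    simp only [T.symm_apply_apply] at h h'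
    rw [← h, k₃.2, h', ← k₄.2]
  simp only [T.symm_apply_apply] at hβi
  -- the arithmetic-geometric mean deficit is nonnegative, continuous and has integral zero
  have hβc' : Continuous fun s => (A s).symm (Pi.single j 1) j := by
    simpa [Function.comp_def] using hβc.comp T.continuous
  have hge : ∀ s, 2 ≤ A s (Pi.single j 1) j + (A s).symm (Pi.single j 1) j := fun s => by
    nlinarith [sq_nonneg (A s (Pi.single j 1) j - (A s).symm (Pi.single j 1) j), hα s, hβ s, hαβ s]
  have hint : ∫ s, (A s (Pi.single j 1) j * p s + (A s).symm (Pi.single j 1) j * p s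
      - 2 * (1 * p s)) = 0 := by
    rw [integral_sub, integral_add k₁.1 hβi, integral_const_mul, e₁, e₂]
    · ring
    · exact k₁.1.add hβi
    · exact k₄.1.const_mul 2
  have hnn : ∀ s, 0 ≤ A s (Pi.single j 1) j * p s + (A s).symm (Pi.single j 1) j * p s
      - 2 * (1 * p s) := fun s => by nlinarith [hge s, hpos s]
  rw [integral_eq_zero_iff_of_nonneg hnn ((k₁.1.add hβi).sub (k₄.1.const_mul 2))] at hint
  have hz := congrFun ((Continuous.ae_eq_iff_eq volume (by fun_prop) continuous_const).1 hint) s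
  have hsum : A s (Pi.single j 1) j + (A s).symm (Pi.single j 1) j = 2 := by
    have h : (A s (Pi.single j 1) j + (A s).symm (Pi.single j 1) j - 2) * p s = 0 := by
      have : A s (Pi.single j 1) j * p s + (A s).symm (Pi.single j 1) j * p s
        - 2 * (1 * p s) = 0 := hz
      linarith
    rcases mul_eq_zero.1 h with h | h
    · linarith
    · exact absurd h (hpos s).ne'
  have h1 : (A s (Pi.single j 1) j - 1) ^ 2 ≤ 0 := by
    have := hαβ s
    have hb : (A s).symm (Pi.single j 1) j = 2 - A s (Pi.single j 1) j := by linarith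
    rw [hb] at this
    nlinarith
  have h2 : A s (Pi.single j 1) j = 1 := by
    have := pow_eq_zero_iff (two_ne_zero) |>.1 (le_antisymm h1 (sq_nonneg _))
    linarith
  exact ⟨h2, by linarith⟩

/-! ### Diagonal entries of a positive definite matrix and its inverse -/

/-- The quadratic form of `B` at `eⱼ - Bⱼⱼ B⁻¹eⱼ`, a vector which vanishes exactly when `eⱼ` is an
eigenvector of `B`. -/
theorem Matrix.PosDef.dotProduct_mulVec_single_sub_inv {n : ℕ}
    {B : Matrix (Fin n) (Fin n) ℝ} (hB : B.PosDef) (j : Fin n) :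
    (Pi.single j 1 - B j j • (B⁻¹ *ᵥ Pi.single j 1)) ⬝ᵥ
      (B *ᵥ (Pi.single j 1 - B j j • (B⁻¹ *ᵥ Pi.single j 1))) =
      B j j * (B j j * B⁻¹ j j - 1) := by
  have hu : IsUnit B.det := hB.det_pos.ne'.isUnit
  have h1 : B *ᵥ (B⁻¹ *ᵥ Pi.single j 1) = Pi.single j 1 := by
    rw [Matrix.mulVec_mulVec, Matrix.mul_nonsing_inv _ hu, Matrix.one_mulVec]
  rw [Matrix.mulVec_sub, Matrix.mulVec_smul, h1]
  have h2 : (B⁻¹ *ᵥ Pi.single j 1) ⬝ᵥ (B *ᵥ Pi.single j 1) = 1 := by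
    rw [Matrix.dotProduct_mulVec, ← Matrix.mulVec_transpose,
      ← Matrix.conjTranspose_eq_transpose_of_trivial,
      hB.isHermitian.eq, h1]
    simp
  have h3 : (Pi.single j 1 : Fin n → ℝ) ⬝ᵥ (B *ᵥ Pi.single j 1) = B j j := by simp
  have h4 : (B⁻¹ *ᵥ Pi.single j 1) ⬝ᵥ (Pi.single j 1 : Fin n → ℝ) = B⁻¹ j j := by simp
  have h5 : (Pi.single j 1 : Fin n → ℝ) ⬝ᵥ (Pi.single j 1 : Fin n → ℝ) = 1 := by simp
  simp only [sub_dotProduct, dotProduct_sub, smul_dotProduct, dotProduct_smul, h2, h3, h4, h5,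
    smul_eq_mul]
  ring

theorem Matrix.PosDef.one_le_diag_mul_inv_diag {n : ℕ} {B : Matrix (Fin n) (Fin n) ℝ}
    (hB : B.PosDef) (j : Fin n) : 1 ≤ B j j * B⁻¹ j j := by
  have h := hB.posSemidef.dotProduct_mulVec_nonneg
    (Pi.single j 1 - B j j • (B⁻¹ *ᵥ Pi.single j 1))
  rw [star_trivial, hB.dotProduct_mulVec_single_sub_inv] at h
  have := (mul_nonneg_iff_of_pos_left hB.diag_pos).1 h
  linarith

theorem Matrix.PosDef.offDiag_eq_zero_of_diag_mul_inv_diag_eq_one {n : ℕ}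
    {B : Matrix (Fin n) (Fin n) ℝ} (hB : B.PosDef) {i j : Fin n} (h : B j j * B⁻¹ j j = 1)
    (hij : i ≠ j) : B i j = 0 := by
  have hu : IsUnit B.det := hB.det_pos.ne'.isUnit
  have hz : Pi.single j 1 - B j j • (B⁻¹ *ᵥ Pi.single j 1) = 0 := by
    by_contra hne
    have h' := hB.dotProduct_mulVec_pos hne
    rw [star_trivial, hB.dotProduct_mulVec_single_sub_inv, h] at h'
    simp at h'
  have h2 := congrArg (fun x => (B *ᵥ x) i) hz
  simp only [Matrix.mulVec_sub, Matrix.mulVec_smul, Matrix.mulVec_mulVec,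
    Matrix.mul_nonsing_inv _ hu, Matrix.one_mulVec] at h2
  simpa [hij] using h2

/-! ### The real Monge-Ampère equation -/

/-- The vector of partial derivatives of `v`. -/
noncomputable def euclideanGrad {n : ℕ} (v : (Fin n → ℝ) → ℝ) (s : Fin n → ℝ) : Fin n → ℝ :=
  fun i => fderiv ℝ v s (Pi.single i 1)

/-- The matrix of second partial derivatives `∂ⱼ∂ᵢv`. -/
noncomputable def euclideanHess {n : ℕ} (v : (Fin n → ℝ) → ℝ) (s : Fin n → ℝ) :
    Matrix (Fin n) (Fin n) ℝ :=
  Matrix.of fun i j => fderiv ℝ (fun x => euclideanGrad v x i) s (Pi.single j 1)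

theorem fderiv_apply_eq_sum {n : ℕ} (L : (Fin n → ℝ) →L[ℝ] ℝ) (x : Fin n → ℝ) :
    L x = ∑ i, x i * L (Pi.single i 1) := by
  conv_lhs => rw [pi_eq_sum_univ' x]
  simp only [map_sum, map_smul, smul_eq_mul]

theorem contDiff_euclideanGrad {n : ℕ} {v : (Fin n → ℝ) → ℝ} (hv : ContDiff ℝ 2 v) :
    ContDiff ℝ 1 (euclideanGrad v) :=
  contDiff_pi.2 fun _ => (hv.fderiv_right (m := 1) (by norm_num)).clm_apply contDiff_const

theorem fderiv_euclideanGrad_apply {n : ℕ} (v : (Fin n → ℝ) → ℝ)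
    (s ξ : Fin n → ℝ) (i : Fin n) :
    fderiv ℝ (fun x => euclideanGrad v x i) s ξ = (euclideanHess v s *ᵥ ξ) i := by
  rw [fderiv_apply_eq_sum]
  simp [Matrix.mulVec, dotProduct, euclideanHess, mul_comm]

theorem hasFDerivAt_euclideanGrad {n : ℕ} {v : (Fin n → ℝ) → ℝ} (hv : ContDiff ℝ 2 v)
    (s : Fin n → ℝ) (i : Fin n) :
    HasFDerivAt (fun x => euclideanGrad v x i) (fderiv ℝ (fun x => euclideanGrad v x i) s) s :=
  ((contDiff_pi.1 (contDiff_euclideanGrad hv) i).differentiable one_ne_zero s).hasFDerivAt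

/-- Along the segment from `s` to `s'` the derivative of `v` in the direction `s' - s` is strictly
increasing. -/
theorem injective_euclideanGrad {n : ℕ} {v : (Fin n → ℝ) → ℝ} (hv : ContDiff ℝ 2 v)
    (hB : ∀ s, (euclideanHess v s).PosDef) : Function.Injective (euclideanGrad v) := by
  intro s s' h
  by_contra hne
  set d := s' - s with hd
  have hd0 : d ≠ 0 := sub_ne_zero.2 (Ne.symm hne)
  have hder : ∀ t : ℝ, HasDerivAt (fun t : ℝ => ∑ i, d i * euclideanGrad v (s + t • d) i)
      (d ⬝ᵥ (euclideanHess v (s + t • d) *ᵥ d)) t := by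
    intro t
    have hl : HasDerivAt (fun t : ℝ => s + t • d) d t := by
      simpa using ((hasDerivAt_id t).smul_const d).const_add s
    refine HasDerivAt.fun_sum fun i _ => ?_
    rw [← fderiv_euclideanGrad_apply]
    exact ((hasFDerivAt_euclideanGrad hv _ i).comp_hasDerivAt t hl).const_mul (d i)
  have hmono : StrictMono fun t : ℝ => ∑ i, d i * euclideanGrad v (s + t • d) i :=
    strictMono_of_deriv_pos fun t => by
      rw [(hder t).deriv]
      simpa using (hB _).dotProduct_mulVec_pos hd0
  have := hmono (zero_lt_one)
  simp [hd, h] at this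

/-- The gradient takes the value `y` at a minimum of `v - ∑ yᵢ sᵢ`, which is coercive because `v`
grows exponentially where `sᵢ → +∞` and is bounded below where `sᵢ → -∞`. -/
theorem exists_euclideanGrad_eq {n : ℕ} {v : (Fin n → ℝ) → ℝ} (hv : Differentiable ℝ v)
    {a c : ℝ} (hc : 0 < c) (hgrow : ∀ s, a + c * ∑ i, Real.exp (1 / 2 * s i) ≤ v s)
    {y : Fin n → ℝ} (hy : ∀ i, 0 < y i) : ∃ s, euclideanGrad v s = y := by
  choose D hD using fun i =>
    exists_mul_abs_le_mul_exp_sub (b := 1 / 2) hc one_half_pos (hy i)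
  have hcoer : Tendsto (fun s => v s - ∑ i, y i * s i) (cocompact (Fin n → ℝ)) atTop := by
    set K := 1 + ∑ i, (y i)⁻¹ with hK
    have hK0 : 0 < K := by
      have : 0 ≤ ∑ i, (y i)⁻¹ := Finset.sum_nonneg fun i _ => (inv_pos.2 (hy i)).le
      linarith
    have hlin : ∀ s : Fin n → ℝ, ‖s‖ ≤ K * ∑ i, y i * |s i| := by
      intro s
      have hnn : ∀ i ∈ Finset.univ, 0 ≤ y i * |s i| := fun i _ =>
        mul_nonneg (hy i).le (abs_nonneg _)
      refine (pi_norm_le_iff_of_nonneg (mul_nonneg hK0.le (Finset.sum_nonneg hnn))).2 fun i => ?_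
      have h1 : y i * |s i| ≤ ∑ i, y i * |s i| := Finset.single_le_sum hnn (Finset.mem_univ i)
      have h2 : (y i)⁻¹ ≤ K := by
        have : (y i)⁻¹ ≤ ∑ i, (y i)⁻¹ :=
          Finset.single_le_sum (f := fun i => (y i)⁻¹) (fun i _ => (inv_pos.2 (hy i)).le)
            (Finset.mem_univ i)
        linarith
      calc ‖s i‖ = (y i)⁻¹ * (y i * |s i|) := by
            rw [← mul_assoc, inv_mul_cancel₀ (hy i).ne', one_mul, Real.norm_eq_abs]
        _ ≤ K * ∑ i, y i * |s i| := by
            have := hnn i (Finset.mem_univ i)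
            gcongr
    have hlow : ∀ s : Fin n → ℝ, K⁻¹ * ‖s‖ + (a - ∑ i, D i) ≤ v s - ∑ i, y i * s i := by
      intro s
      have h1 : K⁻¹ * ‖s‖ ≤ ∑ i, y i * |s i| := by
        rw [inv_mul_le_iff₀ hK0]
        exact hlin s
      have h2 : ∑ i, y i * |s i| ≤
          ∑ i, (c * Real.exp (1 / 2 * s i) - y i * s i + D i) :=
        Finset.sum_le_sum fun i _ => hD i (s i)
      rw [Finset.sum_add_distrib, Finset.sum_sub_distrib, ← Finset.mul_sum] at h2
      linarith [hgrow s]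
    refine tendsto_atTop_mono hlow (tendsto_atTop_add_const_right _ _ ?_)
    exact (tendsto_norm_cocompact_atTop).const_mul_atTop (inv_pos.2 hK0)
  have hd : Differentiable ℝ fun s : Fin n → ℝ => ∑ i, y i * s i := by fun_prop
  obtain ⟨s, hs⟩ := (hv.sub hd).continuous.exists_forall_le hcoer
  refine ⟨s, funext fun j => ?_⟩
  have hmin : IsLocalMin (fun s => v s - ∑ i, y i * s i) s := Eventually.of_forall hs
  have hz := hmin.fderiv_eq_zero
  have hlinear : HasFDerivAt (fun s : Fin n → ℝ => ∑ i, y i * s i)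
      (∑ i, y i • ContinuousLinearMap.proj (R := ℝ) (φ := fun _ : Fin n => ℝ) i) s :=
    HasFDerivAt.fun_sum fun i _ => (hasFDerivAt_apply i s).const_mul (y i)
  rw [((hv s).hasFDerivAt.fun_sub hlinear).fderiv] at hz
  have := DFunLike.congr_fun hz (Pi.single j 1)
  simp [Pi.single_apply] at this
  simp only [euclideanGrad]
  linarith

/-- The coordinatewise logarithm of the gradient, the transport map `T` for a potential with positive
partial derivatives. -/
noncomputable def logGrad {n : ℕ} (v : (Fin n → ℝ) → ℝ) (s : Fin n → ℝ) : Fin n → ℝ :=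
  fun i => Real.log (euclideanGrad v s i)

/-- The Monge-Ampère equation says that `logGrad v` pushes `exp (∑ sᵢ - v)` to `modelDensity`, and
its derivative is `diag(∇v)⁻¹ D²v`. -/
theorem hess_eq_diagonal_of_realMongeAmpere {n : ℕ} {v : (Fin n → ℝ) → ℝ} (hv : ContDiff ℝ 2 v)
    (hB : ∀ s, (euclideanHess v s).PosDef) (hg : ∀ s i, 0 < euclideanGrad v s i)
    (hdet : ∀ s, (euclideanHess v s).det =
      Real.exp (∑ i, s i + ∑ i, euclideanGrad v s i - v s))
    {a c : ℝ} (hc : 0 < c) (hgrow : ∀ s, a + c * ∑ i, Real.exp (1 / 2 * s i) ≤ v s)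
    (s : Fin n → ℝ) : euclideanHess v s = Matrix.diagonal (euclideanGrad v s) := by
  have hvd : Differentiable ℝ v := hv.differentiable two_ne_zero
  have hu : ∀ s, IsUnit (euclideanHess v s).det := fun s => (hB s).det_pos.ne'.isUnit
  -- the derivative of `logGrad v`, as an invertible matrix
  let M := fun s => Matrix.diagonal (fun i => (euclideanGrad v s i)⁻¹) * euclideanHess v s
  let M' := fun s => (euclideanHess v s)⁻¹ * Matrix.diagonal (euclideanGrad v s)
  have hdd : ∀ s, Matrix.diagonal (euclideanGrad v s) *
      Matrix.diagonal (fun i => (euclideanGrad v s i)⁻¹) = 1 := fun s => by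
    simp [Matrix.diagonal_mul_diagonal, mul_inv_cancel₀ (hg s _).ne']
  have hM'M : ∀ s, M' s * M s = 1 := fun s => by
    change (_ * _) * (_ * _) = _
    rw [mul_assoc, ← mul_assoc (Matrix.diagonal _), hdd, one_mul, Matrix.nonsing_inv_mul _ (hu s)]
  have hMM' : ∀ s, M s * M' s = 1 := fun s => mul_eq_one_comm.1 (hM'M s)
  let A : (Fin n → ℝ) → ((Fin n → ℝ) ≃L[ℝ] (Fin n → ℝ)) := fun s =>
    (Matrix.toLin'OfInv (hM'M s) (hMM' s)).toContinuousLinearEquiv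
  have hAapp : ∀ s ξ, A s ξ = M s *ᵥ ξ := fun s ξ => Matrix.toLin'_apply _ _
  have hAsymm : ∀ s ξ, (A s).symm ξ = M' s *ᵥ ξ := fun s ξ => Matrix.toLin'_apply _ _
  have hcd : ContDiff ℝ 1 (logGrad v) := contDiff_pi.2 fun i =>
    (contDiff_pi.1 (contDiff_euclideanGrad hv) i).log fun s => (hg s i).ne'
  have hA : ∀ s, HasFDerivAt (logGrad v) (A s : (Fin n → ℝ) →L[ℝ] (Fin n → ℝ)) s := by
    intro s
    refine hasFDerivAt_pi'.2 fun i => ?_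
    refine ((hasFDerivAt_euclideanGrad hv s i).log (hg s i).ne').congr_fderiv ?_
    refine ContinuousLinearMap.ext fun ξ => ?_
    change (euclideanGrad v s i)⁻¹ * fderiv ℝ (fun x => euclideanGrad v x i) s ξ = A s ξ i
    rw [hAapp, fderiv_euclideanGrad_apply, ← Matrix.mulVec_mulVec, Matrix.mulVec_diagonal]
  have hinj : Function.Injective (logGrad v) := fun s s' h =>
    injective_euclideanGrad hv hB (funext fun i =>
      Real.log_injOn_pos (hg s i) (hg s' i) (congrFun h i))
  have hsurj : Function.Surjective (logGrad v) := fun η => by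
    obtain ⟨s, hs⟩ := exists_euclideanGrad_eq hvd hc hgrow (y := fun i => Real.exp (η i))
      fun i => Real.exp_pos _
    exact ⟨s, funext fun i => by simp [logGrad, hs]⟩
  have hopen : IsOpenMap (logGrad v) := isOpenMap_of_hasStrictFDerivAt_equiv fun s =>
    hcd.contDiffAt.hasStrictFDerivAt' (hA s) one_ne_zero
  let T := (Equiv.ofBijective _ ⟨hinj, hsurj⟩).toHomeomorphOfContinuousOpen hcd.continuous hopen
  have hTapp : ∀ s i, Real.exp (T s i) = euclideanGrad v s i := fun s i => Real.exp_log (hg s i)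
  have hα : ∀ s j, A s (Pi.single j 1) j = (euclideanGrad v s j)⁻¹ * euclideanHess v s j j :=
    fun s j => by simp [hAapp, M]
  have hβ : ∀ s j, (A s).symm (Pi.single j 1) j =
      (euclideanHess v s)⁻¹ j j * euclideanGrad v s j := fun s j => by simp [hAsymm, M']
  have hαβ : ∀ s j, A s (Pi.single j 1) j * (A s).symm (Pi.single j 1) j =
      euclideanHess v s j j * (euclideanHess v s)⁻¹ j j := fun s j => by
    rw [hα, hβ]
    field_simp [(hg s j).ne']
  have key : ∀ j, A s (Pi.single j 1) j = 1 ∧ (A s).symm (Pi.single j 1) j = 1 := fun j => by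
    refine transport_rigidity (T := T) (A := A) (p := fun s => Real.exp (∑ i, s i - v s)) hA hcd
      (fun s => Real.exp_pos _) ?_ ?_ ?_ j ?_ ?_ ?_ ?_ s
    · have := hv.continuous
      fun_prop
    · obtain ⟨D, hD⟩ := exists_mul_abs_le_mul_exp_sub (b := 1 / 2) hc one_half_pos one_pos
      refine ⟨Real.exp (∑ _i : Fin n, D - a), fun s => ?_⟩
      rw [← Real.exp_add, Real.exp_le_exp]
      have h2 : ∑ i, 1 * |s i| ≤ ∑ i, (c * Real.exp (1 / 2 * s i) - 1 * s i + D) :=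
        Finset.sum_le_sum fun i _ => hD (s i)
      simp only [one_mul] at h2
      rw [Finset.sum_add_distrib, Finset.sum_sub_distrib, ← Finset.mul_sum] at h2
      linarith [hgrow s]
    · intro s
      have hdA : (A s : (Fin n → ℝ) →L[ℝ] (Fin n → ℝ)).det = (M s).det :=
        LinearMap.det_toLin' (M s)
      have hpg : 0 < ∏ i, euclideanGrad v s i := Finset.prod_pos fun i _ => hg s i
      have hm : modelDensity (T s) =
          (∏ i, euclideanGrad v s i) * Real.exp (-∑ i, euclideanGrad v s i) := by
        rw [modelDensity, ← Finset.sum_neg_distrib, Real.exp_sum, ← Finset.prod_mul_distrib]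
        refine Finset.prod_congr rfl fun i _ => ?_
        rw [sub_eq_add_neg, Real.exp_add, hTapp]
      rw [hdA, hm, Matrix.det_mul, Matrix.det_diagonal, hdet, Finset.prod_inv_distrib,
        abs_of_pos (by positivity)]
      have : Real.exp (∑ i, s i - v s) = Real.exp (∑ i, s i + ∑ i, euclideanGrad v s i - v s) *
          Real.exp (-∑ i, euclideanGrad v s i) := by rw [← Real.exp_add]; ring_nf
      rw [this]
      field_simp
    · intro s t
      simp only [hTapp]
      have hl := hasDerivAt_update s j t
      have h1 : HasDerivAt (fun t => ∑ i, Function.update s j t i) 1 t := by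
        have := HasDerivAt.fun_sum fun i (_ : i ∈ Finset.univ) => hasDerivAt_pi.1 hl i
        simpa [Finset.sum_pi_single'] using this
      have h2 : HasDerivAt (fun t => v (Function.update s j t))
          (euclideanGrad v (Function.update s j t) j) t :=
        (hvd (Function.update s j t)).hasFDerivAt.comp_hasDerivAt t hl
      refine (h1.fun_sub h2).exp.congr_deriv ?_
      ring
    · intro s
      rw [hα]
      exact mul_pos (inv_pos.2 (hg s j)) (hB s).diag_pos
    · intro s
      rw [hβ]
      exact mul_pos (hB s).inv.diag_pos (hg s j)
    · intro s
      rw [hαβ]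
      exact (hB s).one_le_diag_mul_inv_diag j
  ext i j
  rcases eq_or_ne i j with rfl | hij
  · have h := (key i).1
    rw [hα, inv_mul_eq_one₀ (hg s i).ne'] at h
    simp [h]
  · rw [Matrix.diagonal_apply_ne _ hij]
    refine (hB s).offDiag_eq_zero_of_diag_mul_inv_diag_eq_one ?_ hij
    rw [← hαβ, (key j).1, (key j).2, one_mul]

/-! ### First and second order convexity inequalities -/

section Convex

variable {E : Type*} [NormedAddCommGroup E] [NormedSpace ℝ E] {u : E → ℝ}

theorem ConvexOn.fderiv_apply_sub_le (hu : ConvexOn ℝ univ u) (hd : Differentiable ℝ u) (x y : E) :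
    fderiv ℝ u x (y - x) ≤ u y - u x := by
  have hline : HasDerivAt (fun t : ℝ => u (x + t • (y - x))) (fderiv ℝ u x (y - x)) 0 := by
    have hl : HasDerivAt (fun t : ℝ => x + t • (y - x)) (y - x) 0 := by
      simpa using ((hasDerivAt_id (0 : ℝ)).smul_const (y - x)).const_add x
    have := (hd (x + (0 : ℝ) • (y - x))).hasFDerivAt.comp_hasDerivAt (0 : ℝ) hl
    simpa [Function.comp_def] using this
  have hconv : ConvexOn ℝ univ fun t : ℝ => u (x + t • (y - x)) := by
    have := hu.comp_affineMap (AffineMap.lineMap (k := ℝ) x y)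
    simpa [Function.comp_def, AffineMap.lineMap_apply, add_comm] using this
  have := hconv.le_slope_of_hasDerivAt (mem_univ 0) (mem_univ 1) zero_lt_one hline
  simpa [slope] using this

theorem ConvexOn.fderiv_fderiv_apply_self_nonneg (hu : ConvexOn ℝ univ u) (hd : ContDiff ℝ 2 u)
    (x ξ : E) : 0 ≤ fderiv ℝ (fderiv ℝ u) x ξ ξ := by
  have hd1 : Differentiable ℝ u := hd.differentiable two_ne_zero
  have hd2 : Differentiable ℝ (fderiv ℝ u) :=
    (hd.fderiv_right (m := 1) (by norm_num)).differentiable one_ne_zero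
  have hmono : Monotone fun t : ℝ => fderiv ℝ u (x + t • ξ) ξ := by
    intro t t' htt
    rcases htt.eq_or_lt with rfl | hlt
    · exact le_rfl
    have h1 := hu.fderiv_apply_sub_le hd1 (x + t • ξ) (x + t' • ξ)
    have h2 := hu.fderiv_apply_sub_le hd1 (x + t' • ξ) (x + t • ξ)
    rw [show x + t' • ξ - (x + t • ξ) = (t' - t) • ξ by module, map_smul, smul_eq_mul] at h1
    rw [show x + t • ξ - (x + t' • ξ) = (t - t') • ξ by module, map_smul, smul_eq_mul] at h2
    change fderiv ℝ u (x + t • ξ) ξ ≤ fderiv ℝ u (x + t' • ξ) ξ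
    by_contra! hc
    nlinarith
  have hl : HasDerivAt (fun t : ℝ => x + t • ξ) ξ 0 := by
    simpa using ((hasDerivAt_id (0 : ℝ)).smul_const ξ).const_add x
  have hG : HasFDerivAt (fun w => fderiv ℝ u w ξ) ((fderiv ℝ (fderiv ℝ u) x).flip ξ) x := by
    simpa using (hd2 x).hasFDerivAt.clm_apply (hasFDerivAt_const ξ x)
  have h : HasDerivAt (fun t : ℝ => fderiv ℝ u (x + t • ξ) ξ) (fderiv ℝ (fderiv ℝ u) x ξ ξ) 0 :=
    hG.comp_hasDerivAt_of_eq 0 hl (by simp)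
  rw [← h.deriv]
  exact hmono.deriv_nonneg

end Convex

/-! ### Toric functions in logarithmic coordinates -/

theorem complexHessian_apply {n : ℕ} {u : (Fin n → ℂ) → ℝ} (hu : ContDiff ℝ 2 u)
    (z : Fin n → ℂ) (j k : Fin n) :
    complexHessian u z j k = (1 / 4) *
      (((fderiv ℝ (fderiv ℝ u) z (Pi.single j 1) (Pi.single k 1) +
        fderiv ℝ (fderiv ℝ u) z (Pi.single j Complex.I) (Pi.single k Complex.I) : ℝ) : ℂ) +
      Complex.I * ((fderiv ℝ (fderiv ℝ u) z (Pi.single j 1) (Pi.single k Complex.I) -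
        fderiv ℝ (fderiv ℝ u) z (Pi.single j Complex.I) (Pi.single k 1) : ℝ) : ℂ)) := by
  have hd1 : Differentiable ℝ u := hu.differentiable two_ne_zero
  have hd2 : Differentiable ℝ (fderiv ℝ u) :=
    (hu.fderiv_right (m := 1) (by norm_num)).differentiable one_ne_zero
  have h1 : ∀ w ξ, fderiv ℝ (fun w => (u w : ℂ)) w ξ = (fderiv ℝ u w ξ : ℂ) := fun w ξ => by
    have := Complex.ofRealCLM.hasFDerivAt.comp w (hd1 w).hasFDerivAt
    have h := this.fderiv
    simp only [Function.comp_def, Complex.ofRealCLM_apply] at h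
    rw [h]
    simp
  have h2 : ∀ η, HasFDerivAt (fun w => ((fderiv ℝ u w η : ℝ) : ℂ))
      (Complex.ofRealCLM.comp ((fderiv ℝ (fderiv ℝ u) z).flip η)) z := fun η => by
    have h := (hd2 z).hasFDerivAt.clm_apply (hasFDerivAt_const η z)
    have := Complex.ofRealCLM.hasFDerivAt.comp z h
    simpa [Function.comp_def] using this
  have h3 : HasFDerivAt (dzbar k fun w => (u w : ℂ)) _ z :=
    (((h2 (Pi.single k 1)).add ((h2 (Pi.single k Complex.I)).const_mul Complex.I)).const_mul
      (1 / 2 : ℂ)).congr_of_eventuallyEq (Eventually.of_forall fun w => by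
        simp [dzbar, h1])
  simp only [complexHessian, Matrix.of_apply, dz, h3.fderiv]
  simp
  ring_nf
  simp
  ring

/-- A toric function is constant along the rotations of the `k`-th coordinate. -/
theorem IsToric.fderiv_rotation {n : ℕ} {u : (Fin n → ℂ) → ℝ} (ht : IsToric u)
    (hu : Differentiable ℝ u) (z : Fin n → ℂ) (k : Fin n) :
    fderiv ℝ u z (Pi.single k (Complex.I * z k)) = 0 := by
  set c : ℝ → Fin n → ℂ := fun τ j =>
    Complex.exp (Complex.I * ((Pi.single k τ : Fin n → ℝ) j : ℂ)) * z j with hc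
  have hc0 : c 0 = z := by funext j; simp [hc]
  have hd : HasDerivAt c (Pi.single k (Complex.I * z k)) 0 := by
    refine hasDerivAt_pi.2 fun j => ?_
    rcases eq_or_ne j k with rfl | hj
    · have h := ((((hasDerivAt_id (0 : ℝ)).ofReal_comp).const_mul Complex.I).cexp).mul_const (z j)
      simpa [hc] using h
    · simpa [hc, hj] using hasDerivAt_const (0 : ℝ) (z j)
  have h1 : HasDerivAt (fun τ => u (c τ)) (fderiv ℝ u (c 0) (Pi.single k (Complex.I * z k))) 0 :=
    (hu (c 0)).hasFDerivAt.comp_hasDerivAt (0 : ℝ) hd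
  have h2 : (fun τ => u (c τ)) = fun _ => u z := funext fun τ => (ht _ z).symm
  rw [h2, hc0] at h1
  exact h1.unique (hasDerivAt_const _ _)

/-- The derivative of the identity `IsToric.fderiv_rotation` in the direction `ξ`. -/
theorem IsToric.fderiv_fderiv_rotation {n : ℕ} {u : (Fin n → ℂ) → ℝ} (ht : IsToric u)
    (hu : ContDiff ℝ 2 u) (z ξ : Fin n → ℂ) (k : Fin n) :
    fderiv ℝ (fderiv ℝ u) z ξ (Pi.single k (Complex.I * z k)) +
      fderiv ℝ u z (Pi.single k (Complex.I * ξ k)) = 0 := by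
  have hd2 : Differentiable ℝ (fderiv ℝ u) :=
    (hu.fderiv_right (m := 1) (by norm_num)).differentiable one_ne_zero
  let Λ : (Fin n → ℂ) →L[ℝ] (Fin n → ℂ) := (ContinuousLinearMap.single ℝ (fun _ => ℂ) k).comp
    ((Complex.I • ContinuousLinearMap.id ℝ ℂ).comp (ContinuousLinearMap.proj k))
  have hΛ : ∀ ξ, Λ ξ = Pi.single k (Complex.I * ξ k) := fun ξ => rfl
  have h := (hd2 z).hasFDerivAt.clm_apply Λ.hasFDerivAt
  have h0 : (fun w => fderiv ℝ u w (Λ w)) = fun _ => 0 := funext fun w =>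
    ht.fderiv_rotation (hu.differentiable two_ne_zero) w k
  rw [h0] at h
  have := DFunLike.congr_fun (h.unique (hasFDerivAt_const _ _)) ξ
  simp only [add_apply, ContinuousLinearMap.comp_apply, hΛ,
    ContinuousLinearMap.flip_apply, zero_apply] at this
  linarith

/-- The point of `ℂⁿ` with positive real coordinates `zⱼ = exp (sⱼ / 2)`, that is, with
`sⱼ = log |zⱼ|²`. -/
noncomputable def expEmb {n : ℕ} (s : Fin n → ℝ) : Fin n → ℂ :=
  fun j => (Real.exp (1 / 2 * s j) : ℂ)

theorem expEmb_apply {n : ℕ} (s : Fin n → ℝ) (j : Fin n) :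
    expEmb s j = (Real.exp (1 / 2 * s j) : ℂ) := rfl

/-- The function `u` in the logarithmic coordinates `sⱼ = log |zⱼ|²`. -/
noncomputable def logPotential {n : ℕ} (u : (Fin n → ℂ) → ℝ) (s : Fin n → ℝ) : ℝ := u (expEmb s)

section Toric

variable {n : ℕ} {u : (Fin n → ℂ) → ℝ}

theorem single_mul_I (k : Fin n) (r : ℝ) :
    (Pi.single k (Complex.I * r) : Fin n → ℂ) = r • Pi.single k Complex.I := by
  rw [← Pi.single_smul]
  congr 1
  rw [Complex.real_smul, mul_comm]

theorem IsToric.fderiv_single_I (ht : IsToric u) (hu : Differentiable ℝ u) (s : Fin n → ℝ)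
    (k : Fin n) : fderiv ℝ u (expEmb s) (Pi.single k Complex.I) = 0 := by
  have h := ht.fderiv_rotation hu (expEmb s) k
  rw [expEmb_apply, single_mul_I, map_smul, smul_eq_mul] at h
  exact (mul_eq_zero.1 h).resolve_left (Real.exp_pos _).ne'

theorem IsToric.fderiv_fderiv_single_one_I (ht : IsToric u) (hu : ContDiff ℝ 2 u)
    (s : Fin n → ℝ) (j k : Fin n) :
    fderiv ℝ (fderiv ℝ u) (expEmb s) (Pi.single j 1) (Pi.single k Complex.I) = 0 := by
  have h := ht.fderiv_fderiv_rotation hu (expEmb s) (Pi.single j 1) k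
  have h0 := ht.fderiv_single_I (hu.differentiable two_ne_zero) s k
  have h1 : fderiv ℝ u (expEmb s) (Pi.single k (Complex.I * (Pi.single j 1 : Fin n → ℂ) k)) = 0 := by
    rcases eq_or_ne k j with rfl | hkj
    · simpa using h0
    · simp [hkj]
  rw [h1, add_zero, expEmb_apply, single_mul_I, map_smul, smul_eq_mul] at h
  exact (mul_eq_zero.1 h).resolve_left (Real.exp_pos _).ne'

theorem IsToric.fderiv_fderiv_single_I_I (ht : IsToric u) (hu : ContDiff ℝ 2 u)
    (s : Fin n → ℝ) (j k : Fin n) :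
    Real.exp (1 / 2 * s k) *
      fderiv ℝ (fderiv ℝ u) (expEmb s) (Pi.single j Complex.I) (Pi.single k Complex.I) =
      if j = k then fderiv ℝ u (expEmb s) (Pi.single k 1) else 0 := by
  have h := ht.fderiv_fderiv_rotation hu (expEmb s) (Pi.single j Complex.I) k
  have h1 : fderiv ℝ u (expEmb s)
      (Pi.single k (Complex.I * (Pi.single j Complex.I : Fin n → ℂ) k)) =
      -if j = k then fderiv ℝ u (expEmb s) (Pi.single k 1) else 0 := by
    rcases eq_or_ne j k with rfl | hkj
    · simp [Pi.single_neg]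
    · simp [hkj, hkj.symm]
  rw [h1] at h
  rw [expEmb_apply, single_mul_I, map_smul, smul_eq_mul] at h
  linarith

/-- At points with positive real coordinates the mixed second derivatives `∂²u/∂xʲ∂yᵏ` vanish and
`∂²u/∂yʲ∂yᵏ = δⱼₖ (∂u/∂xᵏ) / xᵏ`, so the complex Hessian is real there. -/
theorem IsToric.exp_mul_complexHessian_mul_exp (ht : IsToric u) (hu : ContDiff ℝ 2 u)
    (s : Fin n → ℝ) (i j : Fin n) :
    (Real.exp (1 / 2 * s i) : ℂ) * complexHessian u (expEmb s) j i * Real.exp (1 / 2 * s j) =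
      ((1 / 4 * (Real.exp (1 / 2 * s i) * Real.exp (1 / 2 * s j) *
        fderiv ℝ (fderiv ℝ u) (expEmb s) (Pi.single j 1) (Pi.single i 1) +
        if j = i then Real.exp (1 / 2 * s i) * fderiv ℝ u (expEmb s) (Pi.single i 1) else 0) : ℝ) :
          ℂ) := by
  have hsymm : IsSymmSndFDerivAt ℝ u (expEmb s) :=
    hu.contDiffAt.isSymmSndFDerivAt (by simp)
  rw [complexHessian_apply hu, ht.fderiv_fderiv_single_one_I hu,
    hsymm (Pi.single j Complex.I) (Pi.single i 1), ht.fderiv_fderiv_single_one_I hu, sub_zero,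
    Complex.ofReal_zero, mul_zero, add_zero]
  have h := ht.fderiv_fderiv_single_I_I hu s j i
  have h2 : (if j = i then Real.exp (1 / 2 * s i) * fderiv ℝ u (expEmb s) (Pi.single i 1) else 0) =
      Real.exp (1 / 2 * s j) * (Real.exp (1 / 2 * s i) *
      fderiv ℝ (fderiv ℝ u) (expEmb s) (Pi.single j Complex.I) (Pi.single i Complex.I)) := by
    rw [h]
    rcases eq_or_ne j i with rfl | hkj
    · simp
    · simp [hkj]
  rw [h2]
  push_cast
  ring

theorem hasFDerivAt_expEmb (s : Fin n → ℝ) :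
    HasFDerivAt expEmb (ContinuousLinearMap.pi fun j =>
      (1 / 2 * Real.exp (1 / 2 * s j)) • Complex.ofRealCLM.comp
        (ContinuousLinearMap.proj (R := ℝ) (φ := fun _ : Fin n => ℝ) j)) s := by
  refine hasFDerivAt_pi.2 fun j => ?_
  have h := Complex.ofRealCLM.hasFDerivAt.comp s (((hasFDerivAt_apply (𝕜 := ℝ) j s).const_mul
    (1 / 2 : ℝ)).exp)
  refine h.congr_fderiv ?_
  ext ξ
  simp
  ring

/-- The derivative of `expEmb` found in `hasFDerivAt_expEmb`, on a basis vector. -/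
theorem fderiv_expEmb_single (s : Fin n → ℝ) (j : Fin n) :
    (ContinuousLinearMap.pi fun j =>
      (1 / 2 * Real.exp (1 / 2 * s j)) • Complex.ofRealCLM.comp
        (ContinuousLinearMap.proj (R := ℝ) (φ := fun _ : Fin n => ℝ) j)) (Pi.single j 1) =
      (1 / 2 * Real.exp (1 / 2 * s j)) • (Pi.single j 1 : Fin n → ℂ) := by
  funext i
  rcases eq_or_ne i j with rfl | hij
  · simp
  · simp [hij]

theorem contDiff_expEmb : ContDiff ℝ 2 (expEmb (n := n)) :=
  contDiff_pi.2 fun j => Complex.ofRealCLM.contDiff.comp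
    (Real.contDiff_exp.comp (contDiff_const.mul (contDiff_apply ℝ ℝ j)))

theorem contDiff_logPotential (hu : ContDiff ℝ 2 u) : ContDiff ℝ 2 (logPotential u) :=
  hu.comp contDiff_expEmb

theorem euclideanGrad_logPotential (hu : Differentiable ℝ u) (s : Fin n → ℝ) (i : Fin n) :
    euclideanGrad (logPotential u) s i =
      1 / 2 * Real.exp (1 / 2 * s i) * fderiv ℝ u (expEmb s) (Pi.single i 1) := by
  have h : HasFDerivAt (logPotential u) _ s :=
    (hu (expEmb s)).hasFDerivAt.comp s (hasFDerivAt_expEmb s)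
  rw [euclideanGrad, h.fderiv, ContinuousLinearMap.comp_apply, fderiv_expEmb_single, map_smul,
    smul_eq_mul]

theorem euclideanHess_logPotential (hu : ContDiff ℝ 2 u) (s : Fin n → ℝ) (i j : Fin n) :
    euclideanHess (logPotential u) s i j =
      1 / 4 * (Real.exp (1 / 2 * s i) * Real.exp (1 / 2 * s j) *
        fderiv ℝ (fderiv ℝ u) (expEmb s) (Pi.single j 1) (Pi.single i 1) +
        if j = i then Real.exp (1 / 2 * s i) * fderiv ℝ u (expEmb s) (Pi.single i 1) else 0) := by
  have hd2 : Differentiable ℝ (fderiv ℝ u) :=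
    (hu.fderiv_right (m := 1) (by norm_num)).differentiable one_ne_zero
  have e : (fun x => euclideanGrad (logPotential u) x i) = fun s =>
      1 / 2 * Real.exp (1 / 2 * s i) * fderiv ℝ u (expEmb s) (Pi.single i 1) :=
    funext fun s => euclideanGrad_logPotential (hu.differentiable two_ne_zero) s i
  have h1 := (((hasFDerivAt_apply (𝕜 := ℝ) i s).const_mul (1 / 2 : ℝ)).exp).const_mul (1 / 2 : ℝ)
  have h2 := ((hd2 (expEmb s)).hasFDerivAt.comp s (hasFDerivAt_expEmb s)).clm_apply
    (hasFDerivAt_const (Pi.single i (1 : ℂ) : Fin n → ℂ) s)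
  have h := h1.mul h2
  rw [euclideanHess, Matrix.of_apply, e]
  refine (congrArg (fun L => L (Pi.single j 1)) h.fderiv).trans ?_
  have h3 := fderiv_expEmb_single s j
  simp only [add_apply, smul_apply,
    ContinuousLinearMap.comp_apply, ContinuousLinearMap.flip_apply, h3, map_smul, smul_eq_mul,
    zero_apply, map_zero, Function.comp_apply, ContinuousLinearMap.proj_apply]
  rcases eq_or_ne j i with rfl | hij
  · simp
    ring
  · simp [hij, hij.symm]
    ring

theorem ofReal_euclideanHess_logPotential (ht : IsToric u) (hu : ContDiff ℝ 2 u) (s : Fin n → ℝ) :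
    (euclideanHess (logPotential u) s).map Complex.ofReal =
      Matrix.diagonal (expEmb s) * (complexHessian u (expEmb s))ᵀ * Matrix.diagonal (expEmb s) := by
  ext i j
  rw [Matrix.mul_diagonal, Matrix.diagonal_mul, Matrix.transpose_apply, Matrix.map_apply,
    euclideanHess_logPotential hu, ← ht.exp_mul_complexHessian_mul_exp hu]
  rfl

theorem det_euclideanHess_logPotential (ht : IsToric u) (hu : ContDiff ℝ 2 u) (s : Fin n → ℝ) :
    (euclideanHess (logPotential u) s).det =
      Real.exp (∑ i, s i) * (complexHessian u (expEmb s)).det.re := by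
  have h : ((euclideanHess (logPotential u) s).det : ℂ) =
      ((Real.exp (∑ i, s i) : ℝ) : ℂ) * (complexHessian u (expEmb s)).det := by
    have h1 := Complex.ofRealHom.map_det (euclideanHess (logPotential u) s)
    have h2 : ((∏ i, expEmb s i) * ∏ i, expEmb s i) = ((Real.exp (∑ i, s i) : ℝ) : ℂ) := by
      rw [← Finset.prod_mul_distrib, Real.exp_sum, Complex.ofReal_prod]
      refine Finset.prod_congr rfl fun i _ => ?_
      rw [expEmb, ← Complex.ofReal_mul, ← Real.exp_add]
      ring_nf
    rw [← h2]
    refine h1.trans ?_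
    change ((euclideanHess (logPotential u) s).map Complex.ofReal).det = _
    rw [ofReal_euclideanHess_logPotential ht hu]
    simp only [Matrix.det_mul, Matrix.det_diagonal, Matrix.det_transpose]
    ring
  have := congrArg Complex.re h
  rwa [Complex.ofReal_re, Complex.re_ofReal_mul] at this

theorem fderiv_expEmb_self (s : Fin n → ℝ) :
    fderiv ℝ u (expEmb s) (expEmb s) =
      ∑ i, Real.exp (1 / 2 * s i) * fderiv ℝ u (expEmb s) (Pi.single i 1) := by
  have e : expEmb s = ∑ i, Real.exp (1 / 2 * s i) • (Pi.single i 1 : Fin n → ℂ) := by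
    funext j
    simp [expEmb, Finset.sum_apply, Pi.single_apply]
  conv_lhs => arg 2; rw [e]
  simp only [map_sum, map_smul, smul_eq_mul]

theorem det_euclideanHess_eq_exp (ht : IsToric u) (hu : ContDiff ℝ 2 u) (hsol : SolvesShrinkerEq u)
    (s : Fin n → ℝ) : (euclideanHess (logPotential u) s).det =
      Real.exp (∑ i, s i + ∑ i, euclideanGrad (logPotential u) s i - logPotential u s) := by
  obtain ⟨hpos, hlog⟩ := hsol (expEmb s)
  rw [det_euclideanHess_logPotential ht hu, ← Real.exp_log hpos, ← Real.exp_add, hlog,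
    fderiv_expEmb_self, Finset.mul_sum, logPotential]
  simp only [euclideanGrad_logPotential (hu.differentiable two_ne_zero)]
  congr 1
  simp only [mul_assoc]
  ring

/-- The point with `xⁱ` replaced by `-xⁱ` has the same value of `u`, so by convexity `u` is
nondecreasing in `xⁱ` for `xⁱ > 0`. -/
theorem IsToric.fderiv_single_one_nonneg (ht : IsToric u) (hu : Differentiable ℝ u)
    (hconv : ConvexOn ℝ univ u) (s : Fin n → ℝ) (i : Fin n) :
    0 ≤ fderiv ℝ u (expEmb s) (Pi.single i 1) := by
  set r := Real.exp (1 / 2 * s i) with hr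
  have hr0 : 0 < r := Real.exp_pos _
  have h := hconv.fderiv_apply_sub_le hu (expEmb s)
    (expEmb s + (-(2 * r)) • (Pi.single i 1 : Fin n → ℂ))
  have e : u (expEmb s + (-(2 * r)) • (Pi.single i 1 : Fin n → ℂ)) = u (expEmb s) := by
    rw [ht (Pi.single i Real.pi) (expEmb s)]
    congr 1
    funext j
    rcases eq_or_ne j i with rfl | hj
    · simp [mul_comm Complex.I, Complex.exp_pi_mul_I, expEmb, hr]
      ring
    · simp [hj]
  rw [e, sub_self, add_sub_cancel_left, map_smul, smul_eq_mul] at h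
  nlinarith

/-- `D²v` is the pullback of `D²u` plus the nonnegative diagonal matrix `½ ∂ᵢv δᵢⱼ`, and it is
nonsingular by the equation. -/
theorem posDef_euclideanHess_logPotential (ht : IsToric u) (hu : ContDiff ℝ 2 u)
    (hconv : ConvexOn ℝ univ u) (hsol : SolvesShrinkerEq u) (s : Fin n → ℝ) :
    (euclideanHess (logPotential u) s).PosDef := by
  have hsymm : IsSymmSndFDerivAt ℝ u (expEmb s) :=
    hu.contDiffAt.isSymmSndFDerivAt (by simp)
  have hpsd : (euclideanHess (logPotential u) s).PosSemidef := by
    refine Matrix.PosSemidef.of_dotProduct_mulVec_nonneg ?_ fun x => ?_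
    · ext i j
      rw [Matrix.conjTranspose_apply, star_trivial, euclideanHess_logPotential hu,
        euclideanHess_logPotential hu, hsymm (Pi.single i 1) (Pi.single j 1)]
      rcases eq_or_ne i j with rfl | hij
      · rfl
      · rw [if_neg hij, if_neg hij.symm]
        ring
    · set ξ : Fin n → ℂ := ∑ i, (x i * Real.exp (1 / 2 * s i)) • (Pi.single i 1 : Fin n → ℂ) with hξ
      have h0 := hconv.fderiv_fderiv_apply_self_nonneg hu (expEmb s) ξ
      have h1 : fderiv ℝ (fderiv ℝ u) (expEmb s) ξ ξ = ∑ i, ∑ j,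
          x i * (Real.exp (1 / 2 * s i) * Real.exp (1 / 2 * s j) *
            fderiv ℝ (fderiv ℝ u) (expEmb s) (Pi.single j 1) (Pi.single i 1)) * x j := by
        nth_rewrite 2 [hξ]
        simp only [map_sum, map_smul, smul_eq_mul]
        refine Finset.sum_congr rfl fun i _ => ?_
        rw [hξ]
        simp only [map_sum, map_smul, smul_eq_mul, sum_apply,
          smul_apply, Finset.mul_sum]
        exact Finset.sum_congr rfl fun j _ => by ring
      have h2 : star x ⬝ᵥ (euclideanHess (logPotential u) s *ᵥ x) =
          1 / 4 * fderiv ℝ (fderiv ℝ u) (expEmb s) ξ ξ + 1 / 4 * ∑ i, x i ^ 2 *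
            (Real.exp (1 / 2 * s i) * fderiv ℝ u (expEmb s) (Pi.single i 1)) := by
        rw [h1, Finset.mul_sum, Finset.mul_sum, ← Finset.sum_add_distrib]
        simp only [dotProduct, Matrix.mulVec, star_trivial, euclideanHess_logPotential hu]
        refine Finset.sum_congr rfl fun i _ => ?_
        simp only [mul_add, add_mul, Finset.sum_add_distrib, Finset.mul_sum]
        congr 1
        · exact Finset.sum_congr rfl fun j _ => by ring
        · simp
          ring
      rw [h2]
      have h3 : 0 ≤ ∑ i, x i ^ 2 *
          (Real.exp (1 / 2 * s i) * fderiv ℝ u (expEmb s) (Pi.single i 1)) :=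
        Finset.sum_nonneg fun i _ => mul_nonneg (sq_nonneg _) (mul_nonneg (Real.exp_pos _).le
          (ht.fderiv_single_one_nonneg (hu.differentiable two_ne_zero) hconv s i))
      positivity
  rw [hpsd.posDef_iff_det_ne_zero, det_euclideanHess_eq_exp ht hu hsol]
  exact (Real.exp_pos _).ne'

/-- A zero of the nonnegative function `∂ᵢv` would be a minimum of it, and `∂ᵢ∂ᵢv` would vanish
there. -/
theorem euclideanGrad_logPotential_pos (ht : IsToric u) (hu : ContDiff ℝ 2 u)
    (hconv : ConvexOn ℝ univ u) (hsol : SolvesShrinkerEq u) (s : Fin n → ℝ) (i : Fin n) :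
    0 < euclideanGrad (logPotential u) s i := by
  have hd := hu.differentiable two_ne_zero
  have hnn : ∀ s, 0 ≤ euclideanGrad (logPotential u) s i := fun s => by
    rw [euclideanGrad_logPotential hd]
    have := ht.fderiv_single_one_nonneg hd hconv s i
    positivity
  refine (hnn s).lt_of_ne fun h0 => ?_
  have hmin : IsLocalMin (fun s => euclideanGrad (logPotential u) s i) s :=
    Eventually.of_forall fun s' => by simpa only [← h0] using hnn s'
  have := (posDef_euclideanHess_logPotential ht hu hconv hsol s).diag_pos (i := i)
  rw [euclideanHess, Matrix.of_apply, hmin.fderiv_eq_zero] at this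
  simp at this

/-- The lower bound is the tangent plane of `u` at `(1, …, 1)`. -/
theorem exists_le_logPotential (hn : 1 ≤ n) (ht : IsToric u) (hu : ContDiff ℝ 2 u)
    (hconv : ConvexOn ℝ univ u) (hsol : SolvesShrinkerEq u) :
    ∃ a c : ℝ, 0 < c ∧ ∀ s, a + c * ∑ i, Real.exp (1 / 2 * s i) ≤ logPotential u s := by
  have hd := hu.differentiable two_ne_zero
  have : Nonempty (Fin n) := ⟨⟨0, hn⟩⟩
  have hpos : ∀ i, 0 < fderiv ℝ u (expEmb 0) (Pi.single i 1) := fun i => by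
    have := euclideanGrad_logPotential_pos ht hu hconv hsol 0 i
    rw [euclideanGrad_logPotential hd] at this
    exact (pos_iff_pos_of_mul_pos this).1 (by positivity)
  obtain ⟨i₀, hi₀⟩ := Finite.exists_min fun i => fderiv ℝ u (expEmb 0) (Pi.single i 1)
  refine ⟨u (expEmb 0) - ∑ i, fderiv ℝ u (expEmb 0) (Pi.single i 1), _, hpos i₀, fun s => ?_⟩
  have h := hconv.fderiv_apply_sub_le hd (expEmb 0) (expEmb s)
  have e : expEmb s - expEmb 0 =
      ∑ i, (Real.exp (1 / 2 * s i) - 1) • (Pi.single i 1 : Fin n → ℂ) := by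
    funext j
    simp [expEmb, Finset.sum_apply, Pi.single_apply]
  rw [e] at h
  simp only [map_sum, map_smul, smul_eq_mul, sub_mul, one_mul, Finset.sum_sub_distrib] at h
  have h2 : fderiv ℝ u (expEmb 0) (Pi.single i₀ 1) * ∑ i, Real.exp (1 / 2 * s i) ≤
      ∑ i, Real.exp (1 / 2 * s i) * fderiv ℝ u (expEmb 0) (Pi.single i 1) := by
    rw [Finset.mul_sum]
    refine Finset.sum_le_sum fun i _ => ?_
    rw [mul_comm]
    exact mul_le_mul_of_nonneg_left (hi₀ i) (Real.exp_pos _).le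
  rw [logPotential]
  linarith

theorem IsToric.apply_norm (ht : IsToric u) (z : Fin n → ℂ) : u z = u fun i => (‖z i‖ : ℂ) := by
  rw [ht (fun i => (z i).arg) fun i => (‖z i‖ : ℂ)]
  congr 1
  funext i
  rw [mul_comm, mul_comm Complex.I, Complex.norm_mul_exp_arg_mul_I]

end Toric

/-! ### Integration of the diagonal Hessian equation -/

/-- The hypothesis says that each `∂ᵢv` depends on `sᵢ` only and solves `f' = f`. -/
theorem exists_eq_sum_exp_of_hess_eq_diagonal {n : ℕ} {v : (Fin n → ℝ) → ℝ} (hv : ContDiff ℝ 2 v)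
    (h : ∀ s, euclideanHess v s = Matrix.diagonal (euclideanGrad v s)) :
    ∃ b, ∀ s, v s = b + ∑ i, euclideanGrad v 0 i * Real.exp (s i) := by
  have hgrad : ∀ s i, euclideanGrad v s i = euclideanGrad v 0 i * Real.exp (s i) := by
    intro s i
    have hder : ∀ s, HasFDerivAt (fun s => euclideanGrad v s i * Real.exp (-s i))
        (0 : (Fin n → ℝ) →L[ℝ] ℝ) s := by
      intro s
      refine ((hasFDerivAt_euclideanGrad hv s i).mul
        ((hasFDerivAt_apply (𝕜 := ℝ) i s).fun_neg.exp)).congr_fderiv ?_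
      refine ContinuousLinearMap.ext fun ξ => ?_
      simp [fderiv_euclideanGrad_apply, h, Matrix.mulVec_diagonal]
      ring
    have hconst := is_const_of_fderiv_eq_zero (𝕜 := ℝ) (fun s => (hder s).differentiableAt)
      (fun s => (hder s).fderiv) s 0
    simp only [Pi.zero_apply, neg_zero, Real.exp_zero, mul_one] at hconst
    rw [← hconst, mul_assoc, ← Real.exp_add, neg_add_cancel, Real.exp_zero, mul_one]
  have hder : ∀ s, HasFDerivAt (fun s => v s - ∑ i, euclideanGrad v 0 i * Real.exp (s i))
      (0 : (Fin n → ℝ) →L[ℝ] ℝ) s := by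
    intro s
    refine ((hv.differentiable two_ne_zero s).hasFDerivAt.fun_sub (HasFDerivAt.fun_sum fun i _ =>
      ((hasFDerivAt_apply (𝕜 := ℝ) i s).exp).const_mul (euclideanGrad v 0 i))).congr_fderiv ?_
    refine ContinuousLinearMap.ext fun ξ => ?_
    have h1 := fderiv_apply_eq_sum (fderiv ℝ v s) ξ
    simp only [sub_apply, sum_apply,
      smul_apply, ContinuousLinearMap.proj_apply, smul_eq_mul,
      zero_apply, h1, sub_eq_zero]
    refine Finset.sum_congr rfl fun i _ => ?_
    have h2 : fderiv ℝ v s (Pi.single i 1) = euclideanGrad v s i := rfl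
    rw [h2, hgrad s i]
    ring
  refine ⟨v 0 - ∑ i, euclideanGrad v 0 i * Real.exp ((0 : Fin n → ℝ) i), fun s => ?_⟩
  have := is_const_of_fderiv_eq_zero (𝕜 := ℝ) (fun s => (hder s).differentiableAt)
      (fun s => (hder s).fderiv) s 0
  linarith

/-- The logarithmic coordinates reach the points with all coordinates nonzero; the others follow by
continuity, moving all `|zᵢ|` to `|zᵢ| + ε`. -/
theorem IsToric.eq_add_sum_normSq {n : ℕ} {u : (Fin n → ℂ) → ℝ} (ht : IsToric u)
    (hu : Continuous u) {b : ℝ} {c : Fin n → ℝ}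
    (h : ∀ s, logPotential u s = b + ∑ i, c i * Real.exp (s i)) (z : Fin n → ℂ) :
    u z = b + ∑ i, c i * ‖z i‖ ^ 2 := by
  have hε : ∀ ε : ℝ, 0 < ε →
      u (fun i => ((‖z i‖ + ε : ℝ) : ℂ)) = b + ∑ i, c i * (‖z i‖ + ε) ^ 2 := by
    intro ε hε
    have hpos : ∀ i, 0 < ‖z i‖ + ε := fun i => by positivity
    have h1 := h fun i => 2 * Real.log (‖z i‖ + ε)
    have h2 : expEmb (fun i => 2 * Real.log (‖z i‖ + ε)) =
        fun i => ((‖z i‖ + ε : ℝ) : ℂ) := by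
      funext i
      rw [expEmb, ← mul_assoc, one_div, inv_mul_cancel₀ two_ne_zero, one_mul,
        Real.exp_log (hpos i)]
    rw [logPotential, h2] at h1
    rw [h1]
    congr 1
    refine Finset.sum_congr rfl fun i _ => ?_
    rw [two_mul, Real.exp_add, Real.exp_log (hpos i), sq]
  have hc1 : Continuous fun ε : ℝ => u fun i => ((‖z i‖ + ε : ℝ) : ℂ) := by fun_prop
  have hc2 : Continuous fun ε : ℝ => b + ∑ i, c i * (‖z i‖ + ε) ^ 2 := by fun_prop
  have hlim1 := (hc1.tendsto 0).mono_left (nhdsWithin_le_nhds (s := Ioi 0))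
  have hlim2 := (hc2.tendsto 0).mono_left (nhdsWithin_le_nhds (s := Ioi 0))
  have := tendsto_nhds_unique (hlim1.congr' (by
    filter_upwards [self_mem_nhdsWithin] with ε hε' using hε ε hε')) hlim2
  rw [ht.apply_norm z]
  simpa using this

theorem isQuadratic_of_eq_add_sum_normSq {n : ℕ} {u : (Fin n → ℂ) → ℝ} {b : ℝ} {c : Fin n → ℝ}
    {i₀ : Fin n} (hc : c i₀ ≠ 0) (h : ∀ z, u z = b + ∑ i, c i * ‖z i‖ ^ 2) : IsQuadratic u := by
  let re : Fin n → (Fin n → ℂ) →ₗ[ℝ] ℝ := fun i => Complex.reLm.comp (LinearMap.proj i)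
  let im : Fin n → (Fin n → ℂ) →ₗ[ℝ] ℝ := fun i => Complex.imLm.comp (LinearMap.proj i)
  let Q : QuadraticForm ℝ (Fin n → ℂ) := ∑ i, c i •
    (QuadraticMap.linMulLin (re i) (re i) + QuadraticMap.linMulLin (im i) (im i))
  have hQ : ∀ z, Q z = ∑ i, c i * ‖z i‖ ^ 2 := fun z => by
    simp only [Q, sum_apply, smul_apply, add_apply,
      QuadraticMap.linMulLin_apply, smul_eq_mul]
    refine Finset.sum_congr rfl fun i _ => ?_
    rw [← Complex.normSq_eq_norm_sq, Complex.normSq_apply]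
    rfl
  refine ⟨Q, 0, b, fun h0 => hc ?_, fun z => by rw [h, hQ, LinearMap.zero_apply]; ring⟩
  have := hQ (Pi.single i₀ 1)
  rw [h0] at this
  simpa [Pi.single_apply, apply_ite, ite_pow] using this.symm

end

theorem theorem1p4 (n : ℕ) (hn : 1 ≤ n) (u : (Fin n → ℂ) → ℝ)
    (hsmooth : ContDiff ℝ ∞ u) (hconv : ConvexOn ℝ Set.univ u)
    (hsol : SolvesShrinkerEq u) (htoric : IsToric u) :
    IsQuadratic u := by
  have hu : ContDiff ℝ 2 u := by exact_mod_cast contDiff_infty.1 hsmooth 2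
  have hg := euclideanGrad_logPotential_pos htoric hu hconv hsol
  obtain ⟨a, c, hc, hgrow⟩ := exists_le_logPotential hn htoric hu hconv hsol
  obtain ⟨b, hb⟩ := exists_eq_sum_exp_of_hess_eq_diagonal (contDiff_logPotential hu)
    (hess_eq_diagonal_of_realMongeAmpere (contDiff_logPotential hu)
      (posDef_euclideanHess_logPotential htoric hu hconv hsol) hg
      (det_euclideanHess_eq_exp htoric hu hsol) hc hgrow)
  exact isQuadratic_of_eq_add_sum_normSq (i₀ := ⟨0, hn⟩) (hg 0 _).ne'
    (htoric.eq_add_sum_normSq hu.continuous hb)
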